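/- Let $P_0(\xi)=\sum_{|\alpha|\le m}a_\alpha\xi^\alpha$ be a polynomial on $\mathbb{R}^n$ with real coefficients and degree $m\ge 2$, and let $P_0=P_0(D)=\sum_\alpha a_\alpha D^\alpha$, $D_j=-i\,\partial/\partial x_j$. Assume that $\widetilde P_0(\xi)=\big(\sum_{\alpha}|\partial^{\alpha}P_0(\xi)|^2\big)^{1/2}\to\infty$ as $|\xi|\to\infty$. For a bounded open set $\Omega\subset\mathbb{R}^n$ let $H^{P_0}_0(\Omega)$ be the completion of $C_0^\infty(\Omega)$ with respect to the norm $\|\varphi\|_{P_0}=\|P_0(D)\varphi\|_{L^2}$, regarded as a subspace of $L^2(\Omega)$ (on $C_0^\infty(\Omega)$ one has $\|\varphi\|_{L^2}\le C_\Omega\|P_0(D)\varphi\|_{L^2}$). For a bounded real-valued function $V$, call $\lambda\in\mathbb{C}$ a transmission eigenvalue of the acoustic problem on $\Omega$ with potential $V$ if there are $0\ne v\in L^2_{\mathrm{loc}}(\Omega)$ and $0\ne w\in L^2_{\mathrm{loc}}(\Omega)$ with $$(P_0-\lambda)v=0\ \text{ in }\Omega,\qquad (P_0-\lambda(1+V))w=0\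 \text{ in }\Omega,\qquad v-w\in H^{P_0}_0(\Omega),$$ the equations being understood in the sense of distributions. Let $\Omega\subset\mathbb{R}^n$ be a bounded domain (a non-empty connected open set), and let $V\in L^\infty(\mathbb{R}^n)$ be real-valued with $\operatorname{supp}V=\overline\Omega$ and $V\ge\delta_0$ a.e. in $\overline\Omega$ for some constant $\delta_0>0$. Suppose that for every $\varepsilon>0$ and every $\delta>0$ the acoustic problem on the open ball $B_\varepsilon(0)\subset\mathbb{R}^n$ of radius $\varepsilon$ centred at the origin, with constant potential $\delta$, has a non-zero real transmission eigenvalue. Then the set of real transmission eigenvalues of the acoustic problem on $\Omega$ with potential $V$ is infinite. -/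

import Mathlib

open MeasureTheory Filter Topology
open scoped Distributions ENNReal

noncomputable section

namespace AcousticITP

/-- `ℝⁿ` with the Euclidean norm. -/
abbrev Rn (n : ℕ) : Type := EuclideanSpace ℝ (Fin n)

/-- The operator `D_j = -i ∂/∂x_j` on complex valued functions on `ℝⁿ`. -/
def D {n : ℕ} (j : Fin n) (f : Rn n → ℂ) : Rn n → ℂ :=
  fun x => -Complex.I * fderiv ℝ f x (EuclideanSpace.single j 1)

/-- The operator `D^α = D_1^{α_1} ⋯ D_n^{α_n}` for a multi-index `α`. -/
def multiD {n : ℕ} (α : Fin n → ℕ) (f : Rn n → ℂ) : Rn n → ℂ :=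
  (List.finRange n).foldr (fun j g => (D j)^[α j] g) f

/-- The constant coefficient operator `P(D) = ∑_α a_α D^α` attached to the real polynomial
`P(ξ) = ∑_α a_α ξ^α` (its symbol), acting on smooth functions. -/
def diffOp {n : ℕ} (P : MvPolynomial (Fin n) ℝ) (f : Rn n → ℂ) : Rn n → ℂ :=
  fun x => ∑ α ∈ P.support, ((P.coeff α : ℝ) : ℂ) * multiD α f x

/-- The transpose `P(-D) = ∑_α a_α (-1)^{|α|} D^α` of `P(D)` for the bilinear pairing
`∫ f g`. -/
def transposeOp {n : ℕ} (P : MvPolynomial (Fin n) ℝ) (f : Rn n → ℂ) : Rn n → ℂ :=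
  fun x => ∑ α ∈ P.support, ((P.coeff α : ℝ) : ℂ) * (-1) ^ (∑ j, α j) * multiD α f x

/-- `P^{(α)}`, the derivative of order `α` of the polynomial `P`. -/
def polyDeriv {n : ℕ} (α : Fin n → ℕ) (P : MvPolynomial (Fin n) ℝ) :
    MvPolynomial (Fin n) ℝ :=
  (List.finRange n).foldr (fun j Q => (MvPolynomial.pderiv j)^[α j] Q) P

/-- Hörmander's weight `P̃(ξ) = (∑_α |P^{(α)}(ξ)|²)^{1/2}`. The sum over all multi-indices reduces
to those with entries at most the degree of `P`, as the other derivatives of `P` vanish. -/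
def weight {n : ℕ} (P : MvPolynomial (Fin n) ℝ) (ξ : Rn n) : ℝ :=
  Real.sqrt (∑ α ∈ Fintype.piFinset fun _ : Fin n => Finset.range (P.totalDegree + 1),
    (MvPolynomial.eval (fun j => ξ j) (polyDeriv α P)) ^ 2)

/-- `u ∈ H^P_0(Ω)`, the completion of `C_0^∞(Ω)` for the norm `‖φ‖_P = ‖P(D)φ‖_{L²}`. As `Ω` is
bounded, `‖φ‖_{L²} ≤ C ‖P(D)φ‖_{L²}` on `C_0^∞(Ω)`, and the completion is the space of the `L²`
limits of the sequences in `C_0^∞(Ω)` that are Cauchy for `‖·‖_P`. -/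
def MemH0 {n : ℕ} (P : MvPolynomial (Fin n) ℝ) (Ω : TopologicalSpace.Opens (Rn n))
    (u : Rn n → ℂ) : Prop :=
  MemLp u 2 (volume.restrict (Ω : Set (Rn n))) ∧
  ∃ φ : ℕ → 𝓓(Ω, ℂ),
    Tendsto (fun k => eLpNorm (fun x => φ k x - u x) 2 (volume.restrict (Ω : Set (Rn n))))
      atTop (𝓝 0) ∧
    Tendsto (fun p : ℕ × ℕ => eLpNorm (fun x => diffOp P (φ p.1 - φ p.2 : 𝓓(Ω, ℂ)) x) 2 volume)
      atTop (𝓝 0)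

/-- `u ∈ L²_loc(Ω)`. -/
def MemL2Loc {n : ℕ} (Ω : TopologicalSpace.Opens (Rn n)) (u : Rn n → ℂ) : Prop :=
  ∀ K : Set (Rn n), IsCompact K → K ⊆ Ω → MemLp u 2 (volume.restrict K)

/-- `(P(D) - q) u = 0` in the sense of distributions on `Ω`. -/
def SolvesIn {n : ℕ} (P : MvPolynomial (Fin n) ℝ) (Ω : TopologicalSpace.Opens (Rn n))
    (q : Rn n → ℂ) (u : Rn n → ℂ) : Prop :=
  ∀ φ : 𝓓(Ω, ℂ), ∫ x in (Ω : Set (Rn n)), u x * (transposeOp P φ x - q x * φ x) = 0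

/-- `μ` is a transmission eigenvalue of the acoustic interior transmission problem
`(P(D) - μ) v = 0` in `Ω`, `(P(D) - μ (1 + V)) w = 0` in `Ω`, `v - w ∈ H^P_0(Ω)`: it has a solution
with `0 ≠ v ∈ L²_loc(Ω)` and `0 ≠ w ∈ L²_loc(Ω)`. -/
def IsTransmissionEigenvalue {n : ℕ} (P : MvPolynomial (Fin n) ℝ)
    (Ω : TopologicalSpace.Opens (Rn n)) (V : Rn n → ℝ) (μ : ℂ) : Prop :=
  ∃ v w : Rn n → ℂ,
    MemL2Loc Ω v ∧ MemL2Loc Ω w ∧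
    (¬ v =ᵐ[volume.restrict (Ω : Set (Rn n))] 0) ∧
    (¬ w =ᵐ[volume.restrict (Ω : Set (Rn n))] 0) ∧
    SolvesIn P Ω (fun _ => μ) v ∧
    SolvesIn P Ω (fun x => μ * (1 + (V x : ℂ))) w ∧
    MemH0 P Ω (fun x => v x - w x)

/-- The open ball `B_ε(0)` in `ℝⁿ`. -/
def ballO (n : ℕ) (ε : ℝ) : TopologicalSpace.Opens (Rn n) :=
  ⟨Metric.ball 0 ε, Metric.isOpen_ball⟩

/-- The support of (the class of) a measurable function: the complement of the largest open set on
which it vanishes almost everywhere. -/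
def essSupport {n : ℕ} (V : Rn n → ℝ) : Set (Rn n) :=
  (volume.withDensity fun x => ‖V x‖ₑ).support

end AcousticITP

end

/-! For a real `t ≠ 0` put `u = v - w`. Then `(P - t) u = -t V w`, so `w` can be eliminated, and the
problem becomes `(P - t)(1/V)(P - t) u - t (P - t) u = 0` with `u ∈ H^P_0(Ω)`. This is the kernel
equation of the self-adjoint operator `transOp`, whose quadratic form is `∫ (1/V) |(P - t) u|² - t ∫
(P - t) u ū`. A kernel vector `u ≠ 0` gives a transmission eigenvalue
(`isTransmissionEigenvalue_of_transOp_eq_zero`). Neither `v` nor `w` can vanish, for otherwise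
`|P(D) u| ≤ C |u|`, and a Carleman inequality with weight `exp (τ x_j)` would force `u = 0`
(`eq_zero_of_norm_opL_le`).

The proof counts nonpositive directions of this form. It is coercive up to finite rank
(`finiteRankGarding_transOp`), because the growth of `P̃`, Hörmander's inequality and Plancherel
make `H^P_0(Ω) → L²` compact (`exists_finite_rank_le`). Hence for each `t` the dimension of
nonpositive subspaces is bounded, and by a spectral gap argument the maximal dimension is locally
constant in `t` where the kernel is trivial (`isIndex_eventually`). If there were finitely many real
eigenvalues, the line minus these and `0` would have finitely many components, and the dimension
would be bounded uniformly in `t` (`exists_bound_finrank_nonposOn`).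

On the other hand, `N` disjoint translates of a small ball fit into `Ω`. With `δ₀` a lower bound of
`V`, an eigenvalue `t ≠ 0` for the constant potential `δ₀` on the ball gives `u ≠ 0` at which the
form with `1/δ₀` in place of `1/V` is zero (`exists_null_of_isTransmissionEigenvalue`). Since `1/V ≤
1/δ₀`, the form on `Ω` is nonpositive on the span of the `N` translates of `u`
(`exists_nonposOn_transOp`). The parameter `t` depends on `N`, which does no harm because the bound
is uniform in `t`. Counting nonpositive instead of negative directions lets these null vectors be
used without perturbation. -/

noncomputable section

/-! ### Constant coefficient operators on test functions, their adjoints and transposes. -/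

namespace AcousticITP

open Complex

/-- The space of smooth compactly supported complex valued functions on `ℝⁿ`. -/
def CS (n : ℕ) : Submodule ℂ (Rn n → ℂ) where
  carrier := {f | ContDiff ℝ (⊤ : ℕ∞) f ∧ HasCompactSupport f}
  add_mem' := fun hf hg => ⟨hf.1.add hg.1, hf.2.add hg.2⟩
  zero_mem' := ⟨contDiff_const, HasCompactSupport.zero⟩
  smul_mem' := fun c _ hf => ⟨contDiff_const.smul hf.1, hf.2.smul_left (f := fun _ => c)⟩

variable {n : ℕ}

theorem contDiff_CS (f : CS n) : ContDiff ℝ (⊤ : ℕ∞) f.1 := f.2.1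

theorem hasCompactSupport_CS (f : CS n) : HasCompactSupport f.1 := f.2.2

theorem continuous_CS (f : CS n) : Continuous f.1 := (contDiff_CS f).continuous

theorem differentiable_CS (f : CS n) : Differentiable ℝ f.1 := (contDiff_CS f).differentiable (by simp)

theorem contDiff_D (j : Fin n) {f : Rn n → ℂ} (hf : ContDiff ℝ (⊤ : ℕ∞) f) : ContDiff ℝ (⊤ : ℕ∞) (D j f) :=
  contDiff_const.mul ((hf.fderiv_right (m := (⊤ : ℕ∞)) (by simp)).clm_apply contDiff_const)

theorem tsupport_D_subset (j : Fin n) (f : Rn n → ℂ) : tsupport (D j f) ⊆ tsupport f :=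
  (tsupport_mul_subset_right (f := fun _ => -I)).trans
    (tsupport_fderiv_apply_subset ℝ (EuclideanSpace.single j 1))

/-- `D_j` on smooth compactly supported functions. -/
def Dl (j : Fin n) : CS n →ₗ[ℂ] CS n where
  toFun f := ⟨D j f.1, contDiff_D j (contDiff_CS f),
    (hasCompactSupport_CS f).mono' ((subset_tsupport _).trans (tsupport_D_subset j f.1))⟩
  map_add' f g := by
    ext x
    simp only [D, Submodule.coe_add, Pi.add_apply]
    rw [show (f.1 + g.1) = fun x => f.1 x + g.1 x from rfl,
      fderiv_fun_add (differentiable_CS f).differentiableAt (differentiable_CS g).differentiableAt]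
    simp [mul_add]
  map_smul' c f := by
    ext x
    simp only [D, Submodule.coe_smul, Pi.smul_apply, RingHom.id_apply]
    rw [fderiv_const_smul (differentiable_CS f).differentiableAt]
    simp only [smul_apply, smul_eq_mul]
    ring

theorem Dl_apply (j : Fin n) (f : CS n) : (Dl j f).1 = D j f.1 := rfl

theorem Dl_comm (j k : Fin n) : Dl j * Dl k = Dl k * Dl j := by
  ext f x
  have hd : Differentiable ℝ (fderiv ℝ f.1) :=
    ((contDiff_CS f).fderiv_right (m := 1) (by norm_cast)).differentiable (by simp)
  have key : ∀ a b : Fin n, ((Dl a * Dl b) f).1 x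
      = -(fderiv ℝ (fderiv ℝ f.1) x (EuclideanSpace.single a 1) (EuclideanSpace.single b 1)) := by
    intro a b
    change D a (D b f.1) x = _
    unfold D
    rw [fderiv_const_mul ((hd x).clm_apply (differentiableAt_const _)),
      fderiv_clm_apply (hd x) (differentiableAt_const _)]
    simp [← mul_assoc]
  rw [key, key]
  congr 1
  have hs : IsSymmSndFDerivAt ℝ f.1 x :=
    (contDiff_CS f).contDiffAt.isSymmSndFDerivAt (by simp only [minSmoothness_of_isRCLikeNormedField]; exact WithTop.coe_le_coe.2 (le_top (a := (2 : ℕ∞))))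
  exact hs _ _

/-- Polynomials can be evaluated only in a commutative algebra, so `rho` is built inside the
subalgebra generated by the commuting `D_j`. -/
theorem isMulCommutative_adjoin_Dl (n : ℕ) :
    IsMulCommutative (Algebra.adjoin ℂ (Set.range (Dl (n := n)))) :=
  Algebra.isMulCommutative_adjoin ℂ (by rintro _ ⟨i, rfl⟩ _ ⟨j, rfl⟩; exact Dl_comm i j)

open scoped IsMulCommutative in
/-- The action of polynomials on smooth compactly supported functions by constant coefficient
differential operators: `X_j` acts as `D_j`. -/
def rho (n : ℕ) : MvPolynomial (Fin n) ℂ →ₐ[ℂ] Module.End ℂ (CS n) :=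
  haveI := isMulCommutative_adjoin_Dl n
  (Algebra.adjoin ℂ (Set.range (Dl (n := n)))).val.comp
    (MvPolynomial.aeval (R := ℂ) (S₁ := Algebra.adjoin ℂ (Set.range (Dl (n := n))))
      fun j => ⟨Dl j, Algebra.subset_adjoin ⟨j, rfl⟩⟩)

open scoped IsMulCommutative in
@[simp] theorem rho_X (j : Fin n) : rho n (MvPolynomial.X j) = Dl j :=
  haveI := isMulCommutative_adjoin_Dl n
  congrArg Subtype.val (MvPolynomial.aeval_X (R := ℂ)
    (fun j => (⟨Dl j, Algebra.subset_adjoin ⟨j, rfl⟩⟩ :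
      Algebra.adjoin ℂ (Set.range (Dl (n := n))))) j)

@[simp] theorem rho_C (c : ℂ) : rho n (MvPolynomial.C c) = c • (1 : Module.End ℂ (CS n)) := by
  rw [← MvPolynomial.algebraMap_eq, AlgHom.commutes, Algebra.algebraMap_eq_smul_one]

theorem rho_mul_apply (p q : MvPolynomial (Fin n) ℂ) (f : CS n) :
    rho n (p * q) f = rho n p (rho n q f) := by
  rw [map_mul]; rfl

theorem rho_comm_apply (p q : MvPolynomial (Fin n) ℂ) (f : CS n) :
    rho n p (rho n q f) = rho n q (rho n p f) := by
  rw [← rho_mul_apply, mul_comm, rho_mul_apply]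

theorem tsupport_rho_subset (Q : MvPolynomial (Fin n) ℂ) (f : CS n) :
    tsupport (rho n Q f).1 ⊆ tsupport f.1 := by
  induction Q using MvPolynomial.induction_on generalizing f with
  | C a =>
    rw [rho_C]
    exact tsupport_smul_subset_right (fun _ => a) f.1
  | add p q hp hq =>
    rw [map_add]
    exact (tsupport_add _ _).trans (Set.union_subset (hp f) (hq f))
  | mul_X p j hp =>
    rw [rho_mul_apply, rho_X]
    exact (hp _).trans (tsupport_D_subset j f.1)

/-- The complexification of a real polynomial. -/
abbrev cx (P : MvPolynomial (Fin n) ℝ) : MvPolynomial (Fin n) ℂ :=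
  MvPolynomial.map Complex.ofRealHom P

theorem rho_monomial_eq_multiD (α : Fin n →₀ ℕ) (c : ℂ) (f : CS n) :
    (rho n (MvPolynomial.monomial α c) f).1 = fun x => c * multiD α f.1 x := by
  have h : ∀ l : List (Fin n),
      (rho n ((l.map fun j => (MvPolynomial.X j : MvPolynomial (Fin n) ℂ) ^ α j).prod) f).1
        = l.foldr (fun j g => (D j)^[α j] g) f.1 := by
    intro l
    induction l with
    | nil => simp
    | cons j l ih =>
      rw [List.map_cons, List.prod_cons, rho_mul_apply, List.foldr_cons, ← ih, map_pow, rho_X]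
      generalize rho n (l.map fun j => (MvPolynomial.X j : MvPolynomial (Fin n) ℂ) ^ α j).prod f = g
      induction α j generalizing g with
      | zero => rfl
      | succ k hk => rw [pow_succ, Function.iterate_succ_apply]; exact hk (Dl j g)
  rw [MvPolynomial.monomial_eq, rho_mul_apply, Finsupp.prod_fintype _ _ (by simp),
    Fin.prod_univ_def, rho_C]
  ext x
  change c * (rho n _ f).1 x = _
  rw [h]
  rfl

theorem rho_eq_sum (Q : MvPolynomial (Fin n) ℂ) (f : CS n) :
    (rho n Q f).1 = fun x => ∑ α ∈ Q.support, Q.coeff α * multiD α f.1 x := by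
  conv_lhs => rw [Q.as_sum, map_sum]
  rw [LinearMap.sum_apply, Submodule.coe_sum]
  ext x
  rw [Finset.sum_apply]
  exact Finset.sum_congr rfl fun α _ => by rw [rho_monomial_eq_multiD]

theorem diffOp_eq_rho (P : MvPolynomial (Fin n) ℝ) (f : CS n) :
    diffOp P f.1 = (rho n (cx P) f).1 := by
  rw [rho_eq_sum, cx, MvPolynomial.support_map_of_injective _ Complex.ofRealHom.injective]
  ext x
  simp [diffOp, MvPolynomial.coeff_map]

/-- The embedding of smooth compactly supported functions in `L²`. -/
def toL2 (n : ℕ) : CS n →ₗ[ℂ] Lp ℂ 2 (volume : Measure (Rn n)) where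
  toFun f := ((continuous_CS f).memLp_of_hasCompactSupport (hasCompactSupport_CS f)).toLp f.1
  map_add' f g := by
    rw [← MemLp.toLp_add]; rfl
  map_smul' c f := by
    simp only [RingHom.id_apply]
    rw [← MemLp.toLp_const_smul]; rfl

theorem coeFn_toL2 (f : CS n) : toL2 n f =ᵐ[volume] f.1 :=
  MemLp.coeFn_toLp ((continuous_CS f).memLp_of_hasCompactSupport (hasCompactSupport_CS f))

theorem inner_toL2 (f g : CS n) :
    inner ℂ (toL2 n f) (toL2 n g) = ∫ x, g.1 x * (starRingEnd ℂ) (f.1 x) := by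
  rw [L2.inner_def]
  refine integral_congr_ae ?_
  filter_upwards [coeFn_toL2 f, coeFn_toL2 g] with x hf hg
  rw [hf, hg]; rfl

theorem integrable_mul_CS (f g : CS n) : Integrable fun x => f.1 x * g.1 x :=
  ((continuous_CS f).mul (continuous_CS g)).integrable_of_hasCompactSupport
    ((hasCompactSupport_CS f).mul_right)

/-- The pointwise complex conjugate of a smooth compactly supported function. -/
def cconj (f : CS n) : CS n :=
  ⟨fun x => (starRingEnd ℂ) (f.1 x), Complex.conjCLE.contDiff.comp (contDiff_CS f),
    (hasCompactSupport_CS f).comp_left (map_zero _)⟩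

theorem D_conj (j : Fin n) (f : CS n) : Dl j (cconj f) = - cconj (Dl j f) := by
  ext x
  change -I * fderiv ℝ (fun x => (starRingEnd ℂ) (f.1 x)) x _ =
    - (starRingEnd ℂ) (-I * fderiv ℝ f.1 x _)
  have : fderiv ℝ (fun x => (starRingEnd ℂ) (f.1 x)) x
      = (Complex.conjCLE : ℂ →L[ℝ] ℂ).comp (fderiv ℝ f.1 x) :=
    ((Complex.conjCLE : ℂ →L[ℝ] ℂ).hasFDerivAt.comp x ((differentiable_CS f) x).hasFDerivAt).fderiv
  rw [this]
  simp

theorem integral_mul_Dl (j : Fin n) (f g : CS n) :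
    ∫ x, f.1 x * (Dl j g).1 x = - ∫ x, (Dl j f).1 x * g.1 x := by
  have h := integral_mul_fderiv_eq_neg_fderiv_mul_of_integrable (μ := volume)
    (f := f.1) (g := g.1) (v := EuclideanSpace.single j 1) ?_ ?_ (integrable_mul_CS f g)
    (fun x _ => (differentiable_CS f) x) (fun x _ => (differentiable_CS g) x)
  · calc ∫ x, f.1 x * (Dl j g).1 x
        = ∫ x, -I * (f.1 x * fderiv ℝ g.1 x (EuclideanSpace.single j 1)) := by
          refine integral_congr_ae (ae_of_all _ fun x => ?_)
          simp only [Dl_apply, D]; ring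
      _ = -(-I * ∫ x, fderiv ℝ f.1 x (EuclideanSpace.single j 1) * g.1 x) := by
          rw [integral_const_mul, h]; ring
      _ = _ := by
          rw [← integral_const_mul]
          congr 1
          refine integral_congr_ae (ae_of_all _ fun x => ?_)
          simp only [Dl_apply, D]; ring
  · refine ((integrable_mul_CS (Dl j f) g).const_mul I).congr (ae_of_all _ fun x => ?_)
    simp only [Dl_apply, D, ← mul_assoc]; simp
  · refine ((integrable_mul_CS f (Dl j g)).const_mul I).congr (ae_of_all _ fun x => ?_)
    simp only [Dl_apply, D]
    ring_nf; simp

theorem inner_Dl (j : Fin n) (f g : CS n) :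
    inner ℂ (toL2 n (Dl j f)) (toL2 n g) = inner ℂ (toL2 n f) (toL2 n (Dl j g)) := by
  rw [inner_toL2, inner_toL2]
  have h := integral_mul_Dl j g (cconj f)
  rw [D_conj] at h
  have h2 : ∫ x, g.1 x * (starRingEnd ℂ) ((Dl j f).1 x)
      = - ∫ x, g.1 x * (-cconj (Dl j f) : CS n).1 x := by
    rw [← integral_neg]
    refine integral_congr_ae (ae_of_all _ fun x => ?_)
    change _ = - (g.1 x * - (starRingEnd ℂ) ((Dl j f).1 x))
    ring
  rw [h2, h, neg_neg]
  rfl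

/-- Each `D_j` is symmetric, so passing to the adjoint only conjugates the coefficients; a real
symbol gives a symmetric operator. -/
theorem inner_rho (Q : MvPolynomial (Fin n) ℂ) (f g : CS n) :
    inner ℂ (toL2 n (rho n Q f)) (toL2 n g)
      = inner ℂ (toL2 n f) (toL2 n (rho n (MvPolynomial.map (starRingEnd ℂ) Q) g)) := by
  induction Q using MvPolynomial.induction_on generalizing f g with
  | C a => simp [inner_smul_left, inner_smul_right]
  | add p q hp hq => simp [inner_add_left, inner_add_right, hp, hq]
  | mul_X p j hp =>
    rw [rho_mul_apply, rho_X, hp, inner_Dl, map_mul, MvPolynomial.map_X, mul_comm, rho_mul_apply,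
      rho_X]

theorem map_conj_cx (P : MvPolynomial (Fin n) ℝ) :
    MvPolynomial.map (starRingEnd ℂ) (cx P) = cx P := by
  rw [cx, MvPolynomial.map_map]
  congr 2
  ext x
  simp

theorem inner_rho_cx (P : MvPolynomial (Fin n) ℝ) (f g : CS n) :
    inner ℂ (toL2 n (rho n (cx P) f)) (toL2 n g) = inner ℂ (toL2 n f) (toL2 n (rho n (cx P) g)) := by
  rw [inner_rho, map_conj_cx]

@[simp] theorem cconj_apply (f : CS n) (x : Rn n) :
    (cconj f).1 x = (starRingEnd ℂ) (f.1 x) := rfl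

theorem rho_monomial_conj (α : Fin n →₀ ℕ) (f : CS n) :
    rho n (MvPolynomial.monomial α 1) (cconj f)
      = (-1 : ℂ) ^ (∑ j, α j) • cconj (rho n (MvPolynomial.monomial α 1) f) := by
  have pow : ∀ (j : Fin n) (k : ℕ) (g : CS n),
      rho n (MvPolynomial.X j ^ k) (cconj g) = (-1 : ℂ) ^ k • cconj (rho n (MvPolynomial.X j ^ k) g) := by
    intro j k
    induction k with
    | zero => intro g; simp
    | succ k ih =>
      intro g
      rw [pow_succ, rho_mul_apply, rho_mul_apply, rho_X, D_conj, map_neg, ih, pow_succ,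
        mul_neg_one]
      exact (neg_smul ((-1 : ℂ) ^ k) _).symm
  have h : ∀ l : List (Fin n),
      rho n ((l.map fun j => (MvPolynomial.X j : MvPolynomial (Fin n) ℂ) ^ α j).prod) (cconj f)
        = (-1 : ℂ) ^ (l.map α).sum •
          cconj (rho n ((l.map fun j => (MvPolynomial.X j : MvPolynomial (Fin n) ℂ) ^ α j).prod) f) := by
    intro l
    induction l with
    | nil => simp
    | cons j l ih =>
      rw [List.map_cons, List.prod_cons, rho_mul_apply, ih, map_smul, pow, rho_mul_apply,
        List.map_cons, List.sum_cons, pow_add, smul_smul, mul_comm]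
  rw [MvPolynomial.monomial_eq, Finsupp.prod_fintype _ _ (by simp), Fin.prod_univ_def,
    map_one, one_mul, h, Fin.sum_univ_def]

/-- Conjugation anticommutes with every `D_j`, so for real coefficients `P(-D)` is `P(D)` conjugated
by complex conjugation. This translates the bilinear pairing of distributions into the sesquilinear
one of `L²`. -/
theorem transposeOp_eq_conj (P : MvPolynomial (Fin n) ℝ) (f : CS n) :
    transposeOp P f.1 = (cconj (rho n (cx P) (cconj f))).1 := by
  ext x
  change _ = (starRingEnd ℂ) ((rho n (cx P) (cconj f)).1 x)
  rw [← diffOp_eq_rho, diffOp, map_sum, transposeOp]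
  refine Finset.sum_congr rfl fun α _ => ?_
  have h := congrArg (fun g : CS n => g.1 x) (rho_monomial_conj α f)
  have h1 := congrFun (rho_monomial_eq_multiD α 1 (cconj f)) x
  have h2 := congrFun (rho_monomial_eq_multiD α 1 f) x
  simp only [one_mul] at h1 h2
  change (rho n (MvPolynomial.monomial α 1) (cconj f)).1 x
    = (-1 : ℂ) ^ (∑ j, α j) * (starRingEnd ℂ) ((rho n (MvPolynomial.monomial α 1) f).1 x) at h
  rw [h1, h2] at h
  rw [h]
  simp only [map_mul, map_pow, map_neg, map_one, Complex.conj_conj, Complex.conj_ofReal]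
  ring

end AcousticITP
end

/-! ### Hörmander's inequality and a Carleman inequality with linear weight. -/

noncomputable section

namespace AcousticITP

open Complex

variable {n : ℕ}

/-- Multiplication by a smooth function. -/
def mulCS (m : Rn n → ℂ) (hm : ContDiff ℝ (⊤ : ℕ∞) m) : CS n →ₗ[ℂ] CS n where
  toFun f := ⟨fun x => m x * f.1 x, hm.mul (contDiff_CS f), (hasCompactSupport_CS f).mul_left⟩
  map_add' f g := by ext x; exact mul_add _ _ _
  map_smul' c f := by ext x; exact mul_left_comm _ _ _

theorem mulCS_apply (m : Rn n → ℂ) (hm : ContDiff ℝ (⊤ : ℕ∞) m) (f : CS n) (x : Rn n) :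
    (mulCS m hm f).1 x = m x * f.1 x := rfl

theorem tsupport_mulCS_subset (m : Rn n → ℂ) (hm : ContDiff ℝ (⊤ : ℕ∞) m) (f : CS n) :
    tsupport (mulCS m hm f).1 ⊆ tsupport f.1 := tsupport_mul_subset_right

theorem Dl_mulCS (m : Rn n → ℂ) (hm : ContDiff ℝ (⊤ : ℕ∞) m) (f : CS n) (j : Fin n) :
    Dl j (mulCS m hm f) = mulCS (D j m) (contDiff_D j hm) f + mulCS m hm (Dl j f) := by
  ext x
  change -I * fderiv ℝ (fun x => m x * f.1 x) x _ = (-I * fderiv ℝ m x _) * f.1 x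
    + m x * (-I * fderiv ℝ f.1 x _)
  rw [fderiv_fun_mul ((hm.differentiable (by simp)) x) (differentiable_CS f x)]
  simp only [add_apply, smul_apply, smul_eq_mul]
  ring

theorem contDiff_coord (j : Fin n) : ContDiff ℝ (⊤ : ℕ∞) fun x : Rn n => ((x j : ℝ) : ℂ) :=
  Complex.ofRealCLM.contDiff.comp (EuclideanSpace.proj (𝕜 := ℝ) j).contDiff

/-- Multiplication by the coordinate `x_j`. -/
def Xl (j : Fin n) : CS n →ₗ[ℂ] CS n := mulCS _ (contDiff_coord j)

theorem hasFDerivAt_coord (j : Fin n) (x : Rn n) :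
    HasFDerivAt (fun x : Rn n => ((x j : ℝ) : ℂ))
      (Complex.ofRealCLM.comp (EuclideanSpace.proj (𝕜 := ℝ) j)) x :=
  (Complex.ofRealCLM.comp (EuclideanSpace.proj j : Rn n →L[ℝ] ℝ)).hasFDerivAt

theorem Dl_Xl (j k : Fin n) (f : CS n) :
    Dl k (Xl j f) = Xl j (Dl k f) - (if k = j then I else 0) • f := by
  rw [Xl, Dl_mulCS]
  ext x
  change D k _ x * f.1 x + _ = _ - _ * f.1 x
  rw [D, (hasFDerivAt_coord j x).fderiv, add_comm, sub_eq_add_neg]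
  congr 1
  simp only [ContinuousLinearMap.comp_apply, PiLp.proj_apply, PiLp.single_apply,
    Complex.ofRealCLM_apply, eq_comm (a := k)]
  split_ifs <;> simp

theorem contDiff_expw (τ : ℝ) (j : Fin n) :
    ContDiff ℝ (⊤ : ℕ∞) fun x : Rn n => Complex.exp (τ * (x j : ℝ)) :=
  (contDiff_const.mul (contDiff_coord j)).cexp

/-- Multiplication by `exp (τ x_j)`. -/
def El (τ : ℝ) (j : Fin n) : CS n →ₗ[ℂ] CS n := mulCS _ (contDiff_expw τ j)

theorem Dl_El (τ : ℝ) (j k : Fin n) (f : CS n) :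
    Dl k (El τ j f) = El τ j (Dl k f) - (if k = j then I * τ else 0) • El τ j f := by
  rw [El, Dl_mulCS]
  ext x
  change D k _ x * f.1 x + _ = _ - _ * (_ * f.1 x)
  rw [D, (((hasFDerivAt_coord j x).const_mul (τ : ℂ)).cexp).fderiv, add_comm, sub_eq_add_neg]
  congr 1
  simp only [ContinuousLinearMap.comp_apply, PiLp.proj_apply, PiLp.single_apply,
    Complex.ofRealCLM_apply, eq_comm (a := k), smul_apply, smul_eq_mul]
  split_ifs
  · simp; ring
  · simp

-- The commutator identity `[Q(D), x_j] = -i (∂_j Q)(D)`, from which Hörmander's inequality is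
-- derived.
open MvPolynomial in
theorem rho_Xl (Q : MvPolynomial (Fin n) ℂ) (j : Fin n) (f : CS n) :
    rho n Q (Xl j f) = Xl j (rho n Q f) - I • rho n (pderiv j Q) f := by
  induction Q using MvPolynomial.induction_on generalizing f with
  | C a => simp
  | add p q hp hq => simp only [map_add, LinearMap.add_apply, hp, hq, smul_add]; abel
  | mul_X p k hp =>
    rw [rho_mul_apply, rho_X, Dl_Xl, map_sub, hp, rho_mul_apply, rho_X, pderiv_mul, map_add,
      LinearMap.add_apply, rho_mul_apply, rho_X, rho_mul_apply, pderiv_X, map_smul, smul_add,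
      sub_sub]
    congr 2
    rcases eq_or_ne k j with rfl | h
    · simp
    · simp [h]

open MvPolynomial

/-- The substitution `ξ ↦ ξ + iτ e_j` in polynomials. -/
def shift (τ : ℝ) (j : Fin n) : MvPolynomial (Fin n) ℂ →ₐ[ℂ] MvPolynomial (Fin n) ℂ :=
  aeval fun k => X k + C (if k = j then I * τ else 0)

theorem shift_X (τ : ℝ) (j k : Fin n) :
    shift τ j (X k) = X k + C (if k = j then I * τ else 0) := aeval_X _ _

theorem shift_C (τ : ℝ) (j : Fin n) (a : ℂ) : shift τ j (C a) = C a := aeval_C _ _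

/-- Conjugation by `exp (τ x_j)` replaces `D_j` by `D_j + iτ`, so weighted estimates for `Q(D)`
become unweighted ones for the shifted symbol. -/
theorem rho_shift_El (Q : MvPolynomial (Fin n) ℂ) (τ : ℝ) (j : Fin n) (f : CS n) :
    rho n (shift τ j Q) (El τ j f) = El τ j (rho n Q f) := by
  induction Q using MvPolynomial.induction_on generalizing f with
  | C a => simp
  | add p q hp hq => simp [hp, hq]
  | mul_X p k hp =>
    rw [map_mul, rho_mul_apply, shift_X, map_add, LinearMap.add_apply, rho_X, rho_C, Dl_El,
      rho_mul_apply, rho_X, ← hp]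
    split_ifs <;> simp

theorem pderiv_shift (Q : MvPolynomial (Fin n) ℂ) (τ : ℝ) (j k : Fin n) :
    pderiv k (shift τ j Q) = shift τ j (pderiv k Q) := by
  induction Q using MvPolynomial.induction_on with
  | C a => simp
  | add p q hp hq => simp [hp, hq]
  | mul_X p l hp =>
    rw [map_mul, shift_X, pderiv_mul, pderiv_mul, hp, map_add, map_add, map_mul, map_mul, shift_X,
      pderiv_C, add_zero]
    congr 2
    rw [pderiv_X, Pi.single_apply]
    split_ifs <;> simp

theorem iterate_pderiv_shift (Q : MvPolynomial (Fin n) ℂ) (τ : ℝ) (j k : Fin n) (m : ℕ) :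
    (pderiv k)^[m] (shift τ j Q) = shift τ j ((pderiv k)^[m] Q) := by
  induction m generalizing Q with
  | zero => rfl
  | succ m ih => rw [Function.iterate_succ_apply, pderiv_shift, ih, Function.iterate_succ_apply]

/-- `Q(D)` is normal: its formal adjoint is the operator with conjugated coefficients, and the two
commute. -/
theorem norm_toL2_rho_conj (Q : MvPolynomial (Fin n) ℂ) (f : CS n) :
    ‖toL2 n (rho n (map (starRingEnd ℂ) Q) f)‖ = ‖toL2 n (rho n Q f)‖ := by
  have h : inner ℂ (toL2 n (rho n Q f)) (toL2 n (rho n Q f))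
      = inner ℂ (toL2 n (rho n (map (starRingEnd ℂ) Q) f))
        (toL2 n (rho n (map (starRingEnd ℂ) Q) f)) := by
    have hQ : map (starRingEnd ℂ) (map (starRingEnd ℂ) Q) = Q := by
      rw [MvPolynomial.map_map]
      convert MvPolynomial.map_id Q
      ext x
      simp
    rw [inner_rho, inner_rho, hQ, rho_comm_apply]
  rw [inner_self_eq_norm_sq_to_K, inner_self_eq_norm_sq_to_K] at h
  have h' : ‖toL2 n (rho n Q f)‖ ^ 2 = ‖toL2 n (rho n (map (starRingEnd ℂ) Q) f)‖ ^ 2 := by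
    exact_mod_cast h
  exact ((sq_eq_sq₀ (norm_nonneg _) (norm_nonneg _)).1 h').symm

theorem norm_toL2_Xl_le {R : ℝ} {j : Fin n} {f : CS n}
    (hf : tsupport f.1 ⊆ {x | |x j| ≤ R}) : ‖toL2 n (Xl j f)‖ ≤ R * ‖toL2 n f‖ := by
  refine Lp.norm_le_mul_norm_of_ae_le_mul ?_
  filter_upwards [coeFn_toL2 f, coeFn_toL2 (Xl j f)] with x h1 h2
  rw [h1, h2, Xl, mulCS_apply, norm_mul]
  by_cases hx : f.1 x = 0
  · simp [hx]
  · gcongr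
    simpa using hf (subset_tsupport _ hx)

/-- Pairing the commutator identity with `a` and applying Cauchy–Schwarz. In the application `a =
(∂_j Q)(D) f`, `u = x_j Q(D) f`, `v = Q(D)(x_j f)`, while `y`, `z`, `w` are `Q̄(D) f`, `x_j (∂_j
Q̄)(D) f`, `(∂_j² Q̄)(D) f`. -/
theorem norm_sq_le_of_commutator {E : Type*} [NormedAddCommGroup E] [InnerProductSpace ℂ E]
    {a u v w y z : E} {R q N M : ℝ} (ha : ‖a‖ = N) (h : I • a = u - v)
    (h' : inner ℂ a v = inner ℂ y (z - I • w)) (hu : ‖u‖ ≤ R * q) (hy : ‖y‖ = q)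
    (hz : ‖z‖ ≤ R * N) (hw : ‖w‖ = M) : N ^ 2 ≤ q * (2 * R * N + M) := by
  have h1 : I * ((N ^ 2 : ℝ) : ℂ) = inner ℂ a u - inner ℂ a v := by
    rw [← inner_sub_right, ← h, inner_smul_right, inner_self_eq_norm_sq_to_K, ha]
    norm_cast
  have h2 : N ^ 2 = ‖I * ((N ^ 2 : ℝ) : ℂ)‖ := by
    rw [norm_mul, Complex.norm_I, one_mul, Complex.norm_real, Real.norm_of_nonneg (by positivity)]
  have hN : 0 ≤ N := ha ▸ norm_nonneg a
  have hq : 0 ≤ q := hy ▸ norm_nonneg y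
  have h3 : ‖z - I • w‖ ≤ R * N + M := by
    refine (norm_sub_le _ _).trans (add_le_add hz ?_)
    rw [norm_smul, Complex.norm_I, one_mul, hw]
  rw [h2, h1, h']
  calc _ ≤ ‖a‖ * ‖u‖ + ‖y‖ * ‖z - I • w‖ :=
        (norm_sub_le _ _).trans (add_le_add (norm_inner_le_norm _ _) (norm_inner_le_norm _ _))
    _ ≤ N * (R * q) + q * (R * N + M) := by rw [ha, hy]; gcongr
    _ = _ := by ring

/-- Hörmander's inequality for a first order derivative of the symbol. -/
theorem norm_rho_pderiv_le {R : ℝ} (hR : 0 ≤ R) (j : Fin n) (m : ℕ) (Q : MvPolynomial (Fin n) ℂ)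
    (hQ : (pderiv j)^[m] Q = 0) (f : CS n) (hf : tsupport f.1 ⊆ {x | |x j| ≤ R}) :
    ‖toL2 n (rho n (pderiv j Q) f)‖ ≤ 2 * m * R * ‖toL2 n (rho n Q f)‖ := by
  induction m generalizing Q with
  | zero =>
    have : Q = 0 := hQ
    simp [this]
  | succ m ih =>
    have ih' := ih (pderiv j Q) hQ
    have hsup : ∀ Q', tsupport (rho n Q' f).1 ⊆ {x | |x j| ≤ R} := fun Q' =>
      (tsupport_rho_subset Q' f).trans hf
    have e1 : I • toL2 n (rho n (pderiv j Q) f)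
        = toL2 n (Xl j (rho n Q f)) - toL2 n (rho n Q (Xl j f)) := by
      rw [rho_Xl, map_sub, map_smul]; abel
    have e2 : inner ℂ (toL2 n (rho n (pderiv j Q) f)) (toL2 n (rho n Q (Xl j f)))
        = inner ℂ (toL2 n (rho n (map (starRingEnd ℂ) Q) f))
          (toL2 n (Xl j (rho n (map (starRingEnd ℂ) (pderiv j Q)) f))
            - I • toL2 n (rho n (map (starRingEnd ℂ) (pderiv j (pderiv j Q))) f)) := by
      have hQ' : Q = map (starRingEnd ℂ) (map (starRingEnd ℂ) Q) := by
        rw [MvPolynomial.map_map]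
        symm
        convert MvPolynomial.map_id Q
        ext x
        simp
      have := inner_rho (map (starRingEnd ℂ) Q) (rho n (pderiv j Q) f) (Xl j f)
      rw [← hQ'] at this
      rw [← this, rho_comm_apply, inner_rho, rho_Xl, map_sub, map_smul, pderiv_map]
    have e4 : ‖toL2 n (Xl j (rho n (map (starRingEnd ℂ) (pderiv j Q)) f))‖
        ≤ R * ‖toL2 n (rho n (pderiv j Q) f)‖ :=
      (norm_toL2_Xl_le (hsup _)).trans_eq (by rw [norm_toL2_rho_conj])
    have e3 := norm_sq_le_of_commutator rfl e1 e2
        (norm_toL2_Xl_le (hsup Q)) (norm_toL2_rho_conj _ _) e4 (norm_toL2_rho_conj _ _)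
    have hq0 : 0 ≤ ‖toL2 n (rho n Q f)‖ := norm_nonneg _
    have hN0 : 0 ≤ ‖toL2 n (rho n (pderiv j Q) f)‖ := norm_nonneg _
    clear e1 e2 e4
    generalize ‖toL2 n (rho n Q f)‖ = q at *
    generalize ‖toL2 n (rho n (pderiv j Q) f)‖ = N at *
    generalize ‖toL2 n (rho n (pderiv j (pderiv j Q)) f)‖ = M at *
    -- With `M ≤ 2mRN` from the induction, `N² ≤ q (2RN + 2mRN)`; dividing by `N` gives the constant
    -- `2(m + 1)R`.
    rcases hN0.eq_or_lt with h0 | hpos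
    · rw [← h0]; positivity
    · push_cast
      refine le_of_mul_le_mul_left ?_ hpos
      nlinarith [mul_le_mul_of_nonneg_left ih' hq0]

theorem coeff_iterate_pderiv_ne_zero {K : Type*} [CommSemiring K] (j : Fin n) (k : ℕ)
    (Q : MvPolynomial (Fin n) K)
    (m : Fin n →₀ ℕ) (h : coeff m ((pderiv j)^[k] Q) ≠ 0) :
    coeff (m + Finsupp.single j k) Q ≠ 0 := by
  induction k generalizing Q m with
  | zero => simpa using h
  | succ k ih =>
    rw [Function.iterate_succ_apply] at h
    have := ih _ _ h
    rw [coeff_pderiv] at this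
    rw [Finsupp.single_add, ← add_assoc]
    exact left_ne_zero_of_mul this

theorem iterate_pderiv_eq_zero {K : Type*} [CommSemiring K] (j : Fin n)
    (Q : MvPolynomial (Fin n) K) :
    (pderiv j)^[Q.totalDegree + 1] Q = 0 := by
  ext m
  by_contra h
  have := le_totalDegree (mem_support_iff.2 (coeff_iterate_pderiv_ne_zero j _ Q m h))
  change Finsupp.degree _ ≤ _ at this
  simp only [map_add, Finsupp.degree_single] at this
  omega

theorem exists_pderiv_ne_zero {K : Type*} [Field K] [CharZero K] (Q : MvPolynomial (Fin n) K)
    (hQ : Q.totalDegree ≠ 0) :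
    ∃ j, pderiv j Q ≠ 0 ∧ (pderiv j Q).totalDegree < Q.totalDegree := by
  have h1 : ∃ m ∈ Q.support, m ≠ 0 := by
    by_contra! h
    apply hQ
    rw [totalDegree_eq_zero_iff]
    intro m hm x
    rw [h m hm]; rfl
  obtain ⟨m, hm, hm0⟩ := h1
  obtain ⟨j, hj⟩ := Finsupp.ne_iff.1 hm0
  have hj' : m j ≠ 0 := hj
  refine ⟨j, ?_, ?_⟩
  · intro h
    have := coeff_pderiv (i := j) Q (m - Finsupp.single j 1)
    rw [h, coeff_zero, tsub_add_cancel_of_le] at this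
    · have h2 := this.symm
      rw [mul_eq_zero] at h2
      rcases h2 with h2 | h2
      · exact mem_support_iff.1 hm h2
      · exact absurd h2 (by norm_cast)
    · rw [Finsupp.single_le_iff]; omega
  · rw [totalDegree, Finset.sup_lt_iff (by simpa using Nat.pos_of_ne_zero hQ)]
    intro b hb
    have := le_totalDegree (mem_support_iff.2
      (coeff_iterate_pderiv_ne_zero j 1 Q b (mem_support_iff.1 hb)))
    change Finsupp.degree _ ≤ _ at this
    change Finsupp.degree _ < _
    simp at this
    omega

/-- A nonzero constant coefficient operator is bounded below on functions supported in a fixed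
bounded set. -/
theorem exists_le_norm_rho {R : ℝ} (hR : 0 ≤ R) (Q : MvPolynomial (Fin n) ℂ) (hQ : Q ≠ 0) :
    ∃ c > 0, ∀ f : CS n, (∀ j, tsupport f.1 ⊆ {x | |x j| ≤ R}) →
      c * ‖toL2 n f‖ ≤ ‖toL2 n (rho n Q f)‖ := by
  induction hd : Q.totalDegree using Nat.strong_induction_on generalizing Q with
  | _ d ih =>
  by_cases h0 : Q.totalDegree = 0
  · rw [totalDegree_eq_zero_iff_eq_C] at h0
    refine ⟨‖coeff 0 Q‖, norm_pos_iff.2 fun h => hQ (by rw [h0, h, C_0]), fun f _ => ?_⟩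
    conv_rhs => rw [h0]
    simp [norm_smul]
  -- Differentiation lowers the degree and, by Hörmander's inequality, costs only a constant; the
  -- recursion ends at a nonzero constant symbol.
  · obtain ⟨j, hj, hlt⟩ := exists_pderiv_ne_zero Q h0
    obtain ⟨c, hc, H⟩ := ih _ (hd ▸ hlt) (pderiv j Q) hj rfl
    set K : ℝ := 2 * (Q.totalDegree + 1 : ℕ) * R + 1 with hK
    have hKpos : 0 < K := by positivity
    refine ⟨c / K, by positivity, fun f hf => ?_⟩
    have h1 := (H f hf).trans (norm_rho_pderiv_le hR j _ Q (iterate_pderiv_eq_zero j Q) f (hf j))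
    rw [div_mul_eq_mul_div, div_le_iff₀ hKpos]
    refine h1.trans ?_
    rw [mul_comm]
    exact mul_le_mul_of_nonneg_left (by rw [hK]; linarith) (norm_nonneg _)

/-- In characteristic zero the hypothesis says that `Q` is affine in `ξ_j`, so Taylor's formula in
that variable stops after the linear term. -/
theorem shift_of_pderiv_pderiv_eq_zero (Q : MvPolynomial (Fin n) ℂ) (τ : ℝ) (j : Fin n)
    (hQ : pderiv j (pderiv j Q) = 0) :
    shift τ j Q = Q + C (I * τ) * pderiv j Q := by
  have hs : ∀ m ∈ Q.support, m j ≤ 1 := by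
    intro m hm
    by_contra! h
    have e : m = m - Finsupp.single j 2 + Finsupp.single j 1 + Finsupp.single j 1 := by
      rw [add_assoc, ← Finsupp.single_add, tsub_add_cancel_of_le]
      rw [Finsupp.single_le_iff]; omega
    have h1 := coeff_pderiv (i := j) (pderiv j Q) (m - Finsupp.single j 2)
    rw [hQ, coeff_zero, coeff_pderiv, ← e] at h1
    have h2 := h1.symm
    simp only [mul_eq_zero, mem_support_iff.1 hm, false_or] at h2
    rcases h2 with h2 | h2 <;> exact absurd h2 (by norm_cast)
  have key : ∀ m ∈ Q.support, shift τ j (monomial m (coeff m Q)) = monomial m (coeff m Q)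
      + C (I * τ) * pderiv j (monomial m (coeff m Q)) := by
    intro m hm
    have hr : ∀ r : Fin n →₀ ℕ, r j = 0 → ∀ a, shift τ j (monomial r a) = monomial r a := by
      intro r hr a
      rw [monomial_eq, map_mul, shift_C, Finsupp.prod_fintype _ _ (by simp), map_prod]
      congr 1
      refine Finset.prod_congr rfl fun k _ => ?_
      rcases eq_or_ne k j with rfl | hk
      · simp [hr]
      · simp [shift_X, hk]
    have h01 : m j = 0 ∨ m j = 1 := by have := hs m hm; omega
    rcases h01 with h | h
    · rw [hr m h, pderiv_monomial, h]; simp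
    · have e : m = m - Finsupp.single j 1 + Finsupp.single j 1 := by
        rw [tsub_add_cancel_of_le]
        rw [Finsupp.single_le_iff]; omega
      rw [pderiv_monomial, h]
      nth_rewrite 1 [e]
      nth_rewrite 3 [e]
      rw [monomial_add_single, map_mul, hr _ (by simp [h]), map_pow, shift_X]
      simp
      ring
  conv_lhs => rw [Q.as_sum]
  conv_rhs => rw [Q.as_sum]
  rw [map_sum, map_sum, Finset.mul_sum, ← Finset.sum_add_distrib]
  exact Finset.sum_congr rfl key

/-- The point is that `K` does not depend on `τ`: Hörmander's constant involves only `R` and the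
number of derivatives that kill the symbol, and the shift commutes with `∂_j`. -/
theorem norm_rho_iterate_pderiv_shift_le {R : ℝ} (hR : 0 ≤ R) (Q : MvPolynomial (Fin n) ℂ)
    (j : Fin n) (k : ℕ) : ∃ K > 0, ∀ (τ : ℝ) (f : CS n), tsupport f.1 ⊆ {x | |x j| ≤ R} →
      ‖toL2 n (rho n (shift τ j ((pderiv j)^[k] Q)) f)‖
        ≤ K * ‖toL2 n (rho n (shift τ j Q) f)‖ := by
  induction k with
  | zero => exact ⟨1, one_pos, fun τ f _ => by simp⟩
  | succ k ih =>
    obtain ⟨K, hK, H⟩ := ih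
    set d := ((pderiv j)^[k] Q).totalDegree + 1
    refine ⟨(2 * d * R + 1) * K, by positivity, fun τ f hf => ?_⟩
    rw [Function.iterate_succ_apply', ← pderiv_shift]
    have h1 := norm_rho_pderiv_le hR j d (shift τ j ((pderiv j)^[k] Q))
      (by rw [iterate_pderiv_shift, iterate_pderiv_eq_zero, map_zero]) f hf
    refine h1.trans ?_
    rw [mul_assoc _ K]
    refine mul_le_mul (by linarith) (H τ f hf) (norm_nonneg _) (by positivity)

/-- A Carleman inequality with linear weight. -/
theorem exists_carleman {R : ℝ} (hR : 0 ≤ R) (P : MvPolynomial (Fin n) ℝ)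
    (hP : P.totalDegree ≠ 0) :
    ∃ (j : Fin n), ∃ c > 0, ∀ (τ : ℝ) (f : CS n), (∀ j, tsupport f.1 ⊆ {x | |x j| ≤ R}) →
      c * |τ| * ‖toL2 n (El τ j f)‖ ≤ ‖toL2 n (El τ j (rho n (cx P) f))‖ := by
  obtain ⟨j, hj, -⟩ := exists_pderiv_ne_zero P hP
  -- For the least such `k`, `S = ∂_j^k P` is affine in `ξ_j` with `∂_j S ≠ 0`, so the shifted
  -- symbol is exactly `S + iτ ∂_j S`.
  have hex : ∃ k, (pderiv j)^[k + 2] P = 0 := by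
    refine ⟨P.totalDegree, ?_⟩
    exact (Function.iterate_succ_apply' (pderiv j) _ P).trans
      (by rw [iterate_pderiv_eq_zero, map_zero])
  classical
  set k := Nat.find hex with hk
  have hk2 : pderiv j (pderiv j ((pderiv j)^[k] P)) = 0 := by
    have := Nat.find_spec hex
    rwa [Function.iterate_succ_apply', Function.iterate_succ_apply'] at this
  have hk1 : pderiv j ((pderiv j)^[k] P) ≠ 0 := by
    rw [← Function.iterate_succ_apply' (pderiv j)]
    rcases Nat.eq_zero_or_pos k with h0 | hpos
    · rw [h0]; exact hj
    · intro h
      refine Nat.find_min hex (m := k - 1) (by omega) ?_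
      rw [show k - 1 + 2 = k.succ by omega]
      exact h
  set S := (pderiv j)^[k] P with hS
  have hit : ∀ k, (pderiv j)^[k] (cx P) = cx ((pderiv j)^[k] P) := by
    intro k
    induction k with
    | zero => rfl
    | succ k ih => rw [Function.iterate_succ_apply', ih, Function.iterate_succ_apply', cx, pderiv_map]
  have hS1 : cx (pderiv j S) ≠ 0 := fun h =>
    hk1 (map_injective _ Complex.ofRealHom.injective (h.trans (map_zero _).symm))
  obtain ⟨c, hc, hlow⟩ := exists_le_norm_rho hR _ hS1
  obtain ⟨K, hK, hup⟩ := norm_rho_iterate_pderiv_shift_le hR (cx P) j k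
  refine ⟨j, c / K, by positivity, fun τ f hf => ?_⟩
  have hf' : ∀ i, tsupport (El τ j f).1 ⊆ {x | |x i| ≤ R} := fun i =>
    (tsupport_mulCS_subset _ _ f).trans (hf i)
  have h1 := hup τ (El τ j f) (hf' j)
  rw [hit, ← hS, rho_shift_El (cx P),
    shift_of_pderiv_pderiv_eq_zero _ _ _ (by rw [cx, pderiv_map, pderiv_map, hk2, map_zero]),
    map_add, LinearMap.add_apply, rho_mul_apply, rho_C, cx, pderiv_map, map_add] at h1
  set g := El τ j f
  set a := toL2 n (rho n (cx S) g)
  set b := toL2 n (rho n (cx (pderiv j S)) g)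
  have h2 : toL2 n (((I * τ) • (1 : Module.End ℂ (CS n))) (rho n (map ofRealHom (pderiv j S)) g))
      = (I * τ) • b := by
    rw [LinearMap.smul_apply, map_smul]; rfl
  rw [h2] at h1
  -- `S(D)` and `(∂_j S)(D)` are symmetric and commute, so `⟨a, b⟩` is real and the cross term is
  -- imaginary. Hence `‖a + iτ b‖² = ‖a‖² + τ² ‖b‖²`.
  have hre : RCLike.re (inner ℂ a ((I * τ) • b)) = 0 := by
    have hsymm : inner ℂ a b = (starRingEnd ℂ) (inner ℂ a b) := by
      rw [inner_conj_symm]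
      simp only [a, b]
      rw [inner_rho_cx, inner_rho_cx, rho_comm_apply]
    rw [inner_smul_right]
    have him : (inner ℂ a b).im = 0 := Complex.conj_eq_iff_im.1 hsymm.symm
    simp [him]
  have h3 : |τ| * ‖b‖ ≤ ‖a + (I * τ) • b‖ := by
    refine abs_le_of_sq_le_sq' ?_ (norm_nonneg _) |>.2
    rw [norm_add_sq (𝕜 := ℂ), hre, norm_smul]
    simp
  have h4 := hlow g hf'
  rw [div_mul_eq_mul_div, div_mul_eq_mul_div, div_le_iff₀ hK]
  calc c * |τ| * ‖toL2 n g‖ = |τ| * (c * ‖toL2 n g‖) := by ring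
    _ ≤ |τ| * ‖b‖ := by gcongr
    _ ≤ _ := h3
    _ ≤ _ := by rw [mul_comm _ K]; exact h1

/-- Hörmander's inequality. -/
theorem exists_norm_rho_polyDeriv_le {R : ℝ} (hR : 0 ≤ R) (P : MvPolynomial (Fin n) ℝ)
    (α : Fin n → ℕ) : ∃ K, 0 ≤ K ∧ ∀ f : CS n, (∀ j, tsupport f.1 ⊆ {x | |x j| ≤ R}) →
      ‖toL2 n (rho n (cx (polyDeriv α P)) f)‖ ≤ K * ‖toL2 n (rho n (cx P) f)‖ := by
  unfold polyDeriv
  induction List.finRange n with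
  | nil => exact ⟨1, zero_le_one, fun f _ => by simp⟩
  | cons j l ih =>
    rw [List.foldr_cons]
    induction α j with
    | zero => exact ih
    | succ k ih2 =>
      obtain ⟨K, hK, H⟩ := ih2
      rw [Function.iterate_succ_apply']
      set Q := (pderiv j)^[k] (List.foldr (fun j Q => (pderiv j)^[α j] Q) P l)
      refine ⟨2 * ((cx Q).totalDegree + 1 : ℕ) * R * K, by positivity, fun f hf => ?_⟩
      have := norm_rho_pderiv_le hR j _ (cx Q) (iterate_pderiv_eq_zero j _) f (hf j)
      rw [cx, pderiv_map] at this
      refine this.trans ?_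
      rw [mul_assoc _ K]
      exact mul_le_mul_of_nonneg_left (H f hf) (by positivity)

end AcousticITP
end

/-! ### Nonpositive subspaces of self-adjoint operators that are coercive up to finite rank. -/

noncomputable section

namespace AcousticITP

section Index

variable {H : Type*} [NormedAddCommGroup H] [InnerProductSpace ℂ H]

/-- The quadratic form of `T` is nonpositive on `W`. -/
def NonposOn (T : H →L[ℂ] H) (W : Submodule ℂ H) : Prop :=
  ∀ u ∈ W, RCLike.re (inner ℂ (T u) u) ≤ 0

/-- The quadratic form of `T` is coercive up to a form of finite rank. -/
def FiniteRankGarding (T : H →L[ℂ] H) : Prop :=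
  ∃ c > 0, ∃ M : ℕ, ∃ g : Fin M → H, ∀ u,
    c * ‖u‖ ^ 2 ≤ RCLike.re (inner ℂ (T u) u) + ∑ i, ‖inner ℂ (g i) u‖ ^ 2

/-- The maximal dimension of a finite dimensional subspace on which `T` is nonpositive is `N`. -/
def IsIndex (T : H →L[ℂ] H) (N : ℕ) : Prop :=
  (∃ W : Submodule ℂ H, FiniteDimensional ℂ W ∧ Module.finrank ℂ W = N ∧ NonposOn T W) ∧
  ∀ W : Submodule ℂ H, FiniteDimensional ℂ W → NonposOn T W → Module.finrank ℂ W ≤ N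

theorem IsIndex.unique {T : H →L[ℂ] H} {N N' : ℕ} (h : IsIndex T N) (h' : IsIndex T N') :
    N = N' := by
  obtain ⟨⟨W, hW, rfl, hn⟩, hmax⟩ := h
  obtain ⟨⟨W', hW', rfl, hn'⟩, hmax'⟩ := h'
  exact le_antisymm (hmax' W hW hn) (hmax W' hW' hn')

/-- The functionals `⟨g i, ·⟩` separate the points of `W`: on their common kernel the form is at
least `c ‖u‖²`. No assumption on the kernel of `T` is needed, so this also covers the exceptional
parameters. -/
theorem FiniteRankGarding.exists_finrank_le {T : H →L[ℂ] H} (hT : FiniteRankGarding T) :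
    ∃ M : ℕ, ∀ W : Submodule ℂ H, NonposOn T W →
      FiniteDimensional ℂ W ∧ Module.finrank ℂ W ≤ M := by
  obtain ⟨c, hc, M, g, hg⟩ := hT
  refine ⟨M, fun W hW => ?_⟩
  let L : H →ₗ[ℂ] (Fin M → ℂ) := LinearMap.pi fun i => (innerSL ℂ (g i)).toLinearMap
  have hinj : Function.Injective (L.comp W.subtype) := by
    rw [← LinearMap.ker_eq_bot, LinearMap.ker_eq_bot']
    intro u hu
    have h0 : ∀ i, inner ℂ (g i) (u : H) = 0 := fun i => congrFun hu i
    have h1 := hg u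
    simp only [h0, norm_zero, ne_eq, OfNat.ofNat_ne_zero, not_false_eq_true, zero_pow,
      Finset.sum_const_zero, add_zero] at h1
    have h2 : ‖(u : H)‖ ^ 2 ≤ 0 := by
      by_contra! h
      have := mul_pos hc h
      linarith [hW u u.2]
    have h3 : ‖(u : H)‖ = 0 := by nlinarith [norm_nonneg (u : H)]
    exact Subtype.ext (norm_eq_zero.1 h3)
  exact ⟨FiniteDimensional.of_injective _ hinj,
    (LinearMap.finrank_le_finrank_of_injective hinj).trans_eq (by simp)⟩

theorem FiniteRankGarding.finiteDimensional {T : H →L[ℂ] H} (hT : FiniteRankGarding T)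
    {W : Submodule ℂ H} (hW : NonposOn T W) : FiniteDimensional ℂ W :=
  (hT.exists_finrank_le.choose_spec W hW).1

variable [CompleteSpace H]

/-- Given unit vectors with `T u_k → 0`, choose a subsequence along which the finitely many `⟨g i,
u_k⟩` converge. The coercivity estimate for differences makes it Cauchy, and its limit is a unit
vector in the kernel. -/
theorem FiniteRankGarding.exists_le_norm {T : H →L[ℂ] H} (hT : FiniteRankGarding T)
    (hker : ∀ u, T u = 0 → u = 0) : ∃ c > 0, ∀ u, c * ‖u‖ ≤ ‖T u‖ := by
  obtain ⟨c, hc, M, g, hg⟩ := hT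
  by_contra! hcon
  have hex : ∀ k : ℕ, ∃ u : H, ‖u‖ = 1 ∧ ‖T u‖ ≤ 1 / ((k : ℝ) + 1) := by
    intro k
    obtain ⟨u, hu⟩ := hcon (1 / ((k : ℝ) + 1)) (by positivity)
    have hu0 : 0 < ‖u‖ := by
      rw [norm_pos_iff]; rintro rfl; simp at hu
    refine ⟨((‖u‖⁻¹ : ℝ) : ℂ) • u, ?_, ?_⟩
    · rw [norm_smul, Complex.norm_real, norm_inv, norm_norm, inv_mul_cancel₀ hu0.ne']
    · rw [map_smul, norm_smul, Complex.norm_real, norm_inv, norm_norm, inv_mul_le_iff₀ hu0,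
        mul_comm]
      exact hu.le
  choose u hu1 hu2 using hex
  let L : H → (Fin M → ℂ) := fun x i => inner ℂ (g i) x
  have hLb : ∀ k, L (u k) ∈ Metric.closedBall (0 : Fin M → ℂ) (∑ i, ‖g i‖) := by
    intro k
    rw [mem_closedBall_zero_iff, pi_norm_le_iff_of_nonneg (by positivity)]
    intro i
    refine (norm_inner_le_norm _ _).trans ?_
    rw [hu1, mul_one]
    exact Finset.single_le_sum (f := fun i => ‖g i‖) (fun _ _ => norm_nonneg _) (Finset.mem_univ i)
  obtain ⟨a, -, φ, hφ, hlim⟩ := (isCompact_closedBall (0 : Fin M → ℂ) (∑ i, ‖g i‖)).tendsto_subseq hLb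
  have hTlim : Tendsto (fun k => ‖T (u (φ k))‖) atTop (𝓝 0) := by
    refine squeeze_zero (fun _ => norm_nonneg _) (fun k => hu2 (φ k)) ?_
    exact tendsto_one_div_add_atTop_nhds_zero_nat.comp hφ.tendsto_atTop
  have hcau : CauchySeq (u ∘ φ) := by
    have hbound : ∀ p : ℕ × ℕ, c * ‖u (φ p.1) - u (φ p.2)‖ ^ 2
        ≤ 2 * (‖T (u (φ p.1))‖ + ‖T (u (φ p.2))‖)
          + ∑ i, ‖L (u (φ p.1)) i - L (u (φ p.2)) i‖ ^ 2 := by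
      intro p
      refine (hg _).trans (add_le_add ?_ (Finset.sum_le_sum fun i _ => ?_))
      · refine (RCLike.re_le_norm _).trans ((norm_inner_le_norm _ _).trans ?_)
        rw [map_sub, mul_comm]
        refine mul_le_mul ?_ (norm_sub_le _ _) (norm_nonneg _) zero_le_two
        refine (norm_sub_le _ _).trans ?_
        rw [hu1, hu1]; norm_num
      · rw [inner_sub_right]
    have hlim' : Tendsto (fun p : ℕ × ℕ => 2 * (‖T (u (φ p.1))‖ + ‖T (u (φ p.2))‖)
          + ∑ i, ‖L (u (φ p.1)) i - L (u (φ p.2)) i‖ ^ 2) atTop (𝓝 0) := by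
      rw [← prod_atTop_atTop_eq]
      have t1 := hTlim.comp (tendsto_fst (f := (atTop : Filter ℕ)) (g := (atTop : Filter ℕ)))
      have t2 := hTlim.comp (tendsto_snd (f := (atTop : Filter ℕ)) (g := (atTop : Filter ℕ)))
      have t3 : ∀ i, Tendsto (fun p : ℕ × ℕ => ‖L (u (φ p.1)) i - L (u (φ p.2)) i‖ ^ 2)
          ((atTop : Filter ℕ) ×ˢ atTop) (𝓝 0) := by
        intro i
        have hi := (tendsto_pi_nhds.1 hlim) i
        have := (((hi.comp (tendsto_fst (f := (atTop : Filter ℕ)) (g := (atTop : Filter ℕ)))).sub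
          (hi.comp (tendsto_snd (f := (atTop : Filter ℕ)) (g := (atTop : Filter ℕ))))).norm).pow 2
        simpa using this
      have := ((t1.add t2).const_mul 2).add (tendsto_finsetSum Finset.univ fun i _ => t3 i)
      simpa using this
    rw [Metric.cauchySeq_iff']
    intro ε hε
    have hev := hlim'.eventually (gt_mem_nhds (show 0 < c * ε ^ 2 by positivity))
    rw [← prod_atTop_atTop_eq] at hev
    obtain ⟨N, hN⟩ := eventually_atTop.1 (prod_atTop_atTop_eq (α := ℕ) (β := ℕ) ▸ hev)
    refine ⟨max N.1 N.2, fun k hk => ?_⟩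
    have := (hbound (k, max N.1 N.2)).trans_lt (hN (k, max N.1 N.2)
      ⟨(le_max_left _ _).trans hk, le_max_right _ _⟩)
    rw [dist_eq_norm]
    refine lt_of_pow_lt_pow_left₀ 2 hε.le ?_
    exact lt_of_mul_lt_mul_left this hc.le
  obtain ⟨v, hv⟩ := cauchySeq_tendsto_of_complete hcau
  have hTv : T v = 0 := by
    have h1 := ((T.continuous.tendsto v).comp hv).norm
    exact norm_eq_zero.1 (tendsto_nhds_unique h1 hTlim)
  have hv1 : ‖v‖ = 1 := by
    refine tendsto_nhds_unique hv.norm ?_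
    simp [hu1]
  rw [hker v hTv, norm_zero] at hv1
  exact zero_ne_one hv1

/-- The lower bound makes the range closed, and by self-adjointness the orthogonal complement of the
range is the trivial kernel. -/
theorem isUnit_of_isSelfAdjoint {T : H →L[ℂ] H} (hT : IsSelfAdjoint T) {c : ℝ} (hc : 0 < c)
    (h : ∀ u, c * ‖u‖ ≤ ‖T u‖) : IsUnit T := by
  rw [ContinuousLinearMap.isUnit_iff_bijective]
  have hanti : AntilipschitzWith (Real.toNNReal c⁻¹) T := by
    refine T.antilipschitz_of_bound fun x => ?_
    rw [Real.coe_toNNReal _ (by positivity), ← div_eq_inv_mul, le_div_iff₀ hc, mul_comm]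
    exact h x
  refine ⟨hanti.injective, ?_⟩
  have hclosed : IsClosed (Set.range T) := hanti.isClosed_range T.uniformContinuous
  have horth : (LinearMap.range T.toLinearMap)ᗮ = ⊥ := by
    rw [Submodule.eq_bot_iff]
    intro x hx
    refine hanti.injective ?_
    rw [map_zero]
    refine ext_inner_right ℂ fun y => ?_
    rw [inner_zero_left]
    have hsym : inner ℂ (T x) y = inner ℂ x (T y) := hT.isSymmetric x y
    rw [hsym]
    exact (Submodule.mem_orthogonal' _ _).1 hx _ ⟨y, rfl⟩
  have hcl : (LinearMap.range T.toLinearMap).topologicalClosure = ⊤ :=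
    Submodule.topologicalClosure_eq_top_iff.2 horth
  rw [IsClosed.submodule_topologicalClosure_eq (by exact hclosed)] at hcl
  exact LinearMap.range_eq_top.1 hcl

/-- The spectral splitting of an invertible self-adjoint operator. -/
theorem exists_splitting {T : H →L[ℂ] H} (hT : IsSelfAdjoint T) (hu : IsUnit T) :
    ∃ c > 0, ∃ P : H →L[ℂ] H, P * P = P ∧
      (∀ u, P u = u → c * ‖u‖ ^ 2 ≤ RCLike.re (inner ℂ (T u) u)) ∧
      (∀ u, P u = 0 → RCLike.re (inner ℂ (T u) u) ≤ -(c * ‖u‖ ^ 2)) := by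
  have h0 : (0 : ℝ) ∉ spectrum ℝ T := spectrum.zero_notMem ℝ hu
  obtain ⟨c, hc, hball⟩ : ∃ c > 0, ∀ x ∈ spectrum ℝ T, c ≤ |x| := by
    have hopen := (spectrum.isClosed (𝕜 := ℝ) T).isOpen_compl
    obtain ⟨ε, hε, hsub⟩ := Metric.isOpen_iff.1 hopen 0 h0
    refine ⟨ε, hε, fun x hx => ?_⟩
    by_contra! hlt
    exact hsub (by simpa using hlt) hx
  -- The spectrum avoids a neighbourhood of `0`, so this step function is continuous on it and the
  -- continuous functional calculus yields the projection onto the positive part.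
  let χ : ℝ → ℝ := fun x => if 0 < x then 1 else 0
  have hcont : ContinuousOn χ (spectrum ℝ T) := by
    intro x hx
    have hx0 : x ≠ 0 := fun h => h0 (h ▸ hx)
    refine ContinuousAt.continuousWithinAt ?_
    rcases hx0.lt_or_gt with hn | hp
    · refine (continuousAt_const (y := (0 : ℝ))).congr ?_
      filter_upwards [gt_mem_nhds hn] with y hy
      simp [χ, hy.le.not_gt]
    · refine (continuousAt_const (y := (1 : ℝ))).congr ?_
      filter_upwards [lt_mem_nhds hp] with y hy
      simp [χ, hy]
  have hid : ContinuousOn (fun x : ℝ => x) (spectrum ℝ T) := continuousOn_id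
  set P := cfc χ T with hP
  have hPsa : IsSelfAdjoint P := cfc_predicate χ T
  have hPT : cfc (fun x => χ x * x) T = P * T := by
    rw [cfc_mul χ (fun x => x) T hcont hid, cfc_id' ℝ T]
  have hle1 : c • P ≤ P * T := by
    rw [← hPT, hP, ← cfc_smul c χ T hcont]
    refine cfc_mono (fun x hx => ?_) (hcont.const_smul c) (hcont.mul hid)
    have := hball x hx
    simp only [χ, smul_eq_mul]
    split_ifs with hpos
    · rw [abs_of_pos hpos] at this; linarith
    · simp
  have hle2 : T + c • (1 : H →L[ℂ] H) ≤ P * T + c • P := by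
    have e1 : T + c • (1 : H →L[ℂ] H) = cfc (fun x => x + c • (1 : ℝ)) T := by
      rw [cfc_add (a := T) (fun x => x) (fun _ => c • (1 : ℝ)) hid continuousOn_const, cfc_id' ℝ T,
        cfc_const _ T, Algebra.algebraMap_eq_smul_one, smul_eq_mul, mul_one]
    have e2 : P * T + c • P = cfc (fun x => χ x * x + c • χ x) T := by
      rw [cfc_add (a := T) (fun x => χ x * x) (fun x => c • χ x) (hcont.mul hid)
        (hcont.const_smul c), hPT, cfc_smul c χ T hcont]
    rw [e1, e2]
    refine cfc_mono (fun x hx => ?_) (hid.add continuousOn_const)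
      ((hcont.mul hid).add (hcont.const_smul c))
    have := hball x hx
    simp only [χ, smul_eq_mul]
    split_ifs with hpos
    · simp
    · rw [abs_of_nonpos (not_lt.1 hpos)] at this; simp; linarith
  have key : ∀ {A B : H →L[ℂ] H}, A ≤ B → ∀ u,
      RCLike.re (inner ℂ (A u) u) ≤ RCLike.re (inner ℂ (B u) u) := by
    intro A B hAB u
    have := ((ContinuousLinearMap.le_def A B).1 hAB).re_inner_nonneg_left u
    simp only [sub_apply, inner_sub_left, map_sub] at this
    linarith
  have hcsm : ∀ (A : H →L[ℂ] H) u, RCLike.re (inner ℂ ((c • A) u) u)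
      = c * RCLike.re (inner ℂ (A u) u) := by
    intro A u
    rw [smul_apply, RCLike.real_smul_eq_coe_smul (K := ℂ), inner_smul_left]
    simp
  have hPsymm : ∀ u v, inner ℂ (P u) v = inner ℂ u (P v) := hPsa.isSymmetric
  refine ⟨c, hc, P, ?_, ?_, ?_⟩
  · rw [hP, ← cfc_mul χ χ T hcont hcont]
    refine cfc_congr fun x _ => ?_
    simp [χ]
  · intro u hu
    have h := key hle1 u
    rw [hcsm, hu, inner_self_eq_norm_sq] at h
    rwa [mul_apply_eq_comp, hPsymm, hu] at h
  · intro u hu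
    have h := key hle2 u
    simp only [add_apply, inner_add_left, map_add, hcsm,
      mul_apply_eq_comp, hPsymm, hu, inner_zero_left, inner_zero_right, map_zero,
      one_apply_eq_self, mul_zero, add_zero, inner_self_eq_norm_sq] at h
    linarith

/-- The index is the dimension of the negative spectral subspace `ker P`. If `‖T' - T‖` is below the
spectral gap `c`, the form of `T'` is still nonpositive on `ker P` and positive definite on the
range of `P`, so `1 - P` maps any nonpositive subspace injectively into `ker P`. -/
theorem isIndex_eventually {T : H →L[ℂ] H} (hT : IsSelfAdjoint T) (hG : FiniteRankGarding T)
    (hker : ∀ u, T u = 0 → u = 0) : ∃ N, ∀ᶠ T' in 𝓝 T, IsIndex T' N := by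
  obtain ⟨c₀, hc₀, hb⟩ := hG.exists_le_norm hker
  obtain ⟨c, hc, P, hPP, hpos, hneg⟩ := exists_splitting hT (isUnit_of_isSelfAdjoint hT hc₀ hb)
  set Hm : Submodule ℂ H := LinearMap.ker P.toLinearMap with hHm
  have hHmnon : NonposOn T Hm := fun u hu =>
    (hneg u hu).trans (neg_nonpos.2 (by positivity))
  have hfd := hG.finiteDimensional hHmnon
  have hdiff : ∀ (T' : H →L[ℂ] H) u,
      |RCLike.re (inner ℂ (T' u) u) - RCLike.re (inner ℂ (T u) u)| ≤ ‖T' - T‖ * ‖u‖ ^ 2 := by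
    intro T' u
    rw [← map_sub, ← inner_sub_left, ← sub_apply]
    refine (RCLike.abs_re_le_norm _).trans ((norm_inner_le_norm _ _).trans ?_)
    rw [pow_two, ← mul_assoc]
    gcongr
    exact (T' - T).le_opNorm u
  refine ⟨Module.finrank ℂ Hm, ?_⟩
  filter_upwards [Metric.ball_mem_nhds T hc] with T' hT'
  rw [Metric.mem_ball, dist_eq_norm] at hT'
  refine ⟨⟨Hm, hfd, rfl, fun u hu => ?_⟩, fun W hW hn => ?_⟩
  · have h1 := (abs_le.1 (hdiff T' u)).2
    have h2 := hneg u hu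
    nlinarith [sq_nonneg ‖u‖]
  · let Q : W →ₗ[ℂ] Hm := LinearMap.codRestrict Hm
      ((1 - P : H →L[ℂ] H).toLinearMap.comp W.subtype) (by
        intro u
        change P ((1 - P : H →L[ℂ] H) u) = 0
        rw [← mul_apply_eq_comp, mul_sub, mul_one, hPP, sub_self]; rfl)
    refine LinearMap.finrank_le_finrank_of_injective (f := Q) ?_
    rw [← LinearMap.ker_eq_bot, LinearMap.ker_eq_bot']
    intro u hu
    have h0 : (1 - P : H →L[ℂ] H) (u : H) = 0 := congrArg Subtype.val hu
    have h1 : P (u : H) = u := by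
      rw [sub_apply, sub_eq_zero] at h0
      exact h0.symm
    have h2 := hpos u h1
    have h3 := (abs_le.1 (hdiff T' (u : H))).1
    have h4 := hn u u.2
    have h5 : ‖(u : H)‖ ^ 2 ≤ 0 := by
      by_contra! h
      nlinarith
    have h6 : ‖(u : H)‖ = 0 := by nlinarith [norm_nonneg (u : H)]
    exact Subtype.ext (norm_eq_zero.1 h6)

/-- A continuous family of self-adjoint operators, each coercive up to a finite rank form, has
bounded index if its kernel is nontrivial at only finitely many parameters. -/
theorem exists_bound_finrank_nonposOn {T : ℝ → H →L[ℂ] H} (hcont : Continuous T)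
    (hT : ∀ t, IsSelfAdjoint (T t)) (hG : ∀ t, FiniteRankGarding (T t)) {F : Set ℝ}
    (hF : F.Finite) (hker : ∀ t ∉ F, ∀ u, T t u = 0 → u = 0) :
    ∃ B : ℕ, ∀ t, ∀ W : Submodule ℂ H, NonposOn (T t) W → Module.finrank ℂ W ≤ B := by
  classical
  have hex : ∀ t : ℝ, ∃ N, t ∉ F → ∀ᶠ s in 𝓝 t, IsIndex (T s) N := by
    intro t
    by_cases ht : t ∈ F
    · exact ⟨0, fun h => absurd ht h⟩
    · obtain ⟨N, hN⟩ := isIndex_eventually (hT t) (hG t) (hker t ht)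
      exact ⟨N, fun _ => hcont.continuousAt.eventually hN⟩
  choose N hN using hex
  have hNcont : ContinuousOn N Fᶜ := by
    intro t ht
    refine ContinuousWithinAt.congr_of_eventuallyEq (f := fun _ => N t) continuousWithinAt_const
      ?_ rfl
    filter_upwards [mem_nhdsWithin_of_mem_nhds (hN t ht), self_mem_nhdsWithin] with s hs hsF
    exact (hN s hsF).self_of_nhds.unique hs
  -- The points of `F` below `t` label the component of the complement of `F` containing `t`; there
  -- are only finitely many labels.
  let key : ℝ → Finset ℝ := fun t => hF.toFinset.filter (· < t)
  have hmono : ∀ s t, s ≤ t → s ∉ F → t ∉ F → key s = key t → N s = N t := by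
    intro s t hst hs ht hk
    refine isPreconnected_Icc.constant (s := Set.Icc s t) (hNcont.mono fun r hr hrF => ?_)
      ⟨le_rfl, hst⟩ ⟨hst, le_rfl⟩
    have h1 : r ∈ key t := by
      simp only [key, Finset.mem_filter, Set.Finite.mem_toFinset]
      exact ⟨hrF, lt_of_le_of_ne hr.2 fun h => ht (h ▸ hrF)⟩
    rw [← hk] at h1
    simp only [key, Finset.mem_filter] at h1
    exact absurd h1.2 (not_lt.2 hr.1)
  have hkey : ∀ s t, s ∉ F → t ∉ F → key s = key t → N s = N t := by
    intro s t hs ht hk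
    rcases le_total s t with h | h
    · exact hmono s t h hs ht hk
    · exact (hmono t s h ht hs hk.symm).symm
  -- The index on the component labelled `K`, read off at a chosen point; labels that do not occur
  -- get the irrelevant value `0`.
  let g : Finset ℝ → ℕ := fun K => if h : ∃ t ∉ F, key t = K then N h.choose else 0
  choose M hM using fun t => (hG t).exists_finrank_le
  refine ⟨max (hF.toFinset.powerset.sup g) (hF.toFinset.sup M), fun t W hW => ?_⟩
  by_cases ht : t ∈ F
  · exact (hM t W hW).2.trans ((Finset.le_sup (f := M) (by simpa using ht)).trans (le_max_right _ _))
  have hg : g (key t) = N t := by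
    have h : ∃ s ∉ F, key s = key t := ⟨t, ht, rfl⟩
    simp only [g, dif_pos h]
    exact hkey _ _ h.choose_spec.1 ht h.choose_spec.2
  refine le_trans ?_ (le_max_left _ _)
  refine ((hN t ht).self_of_nhds.2 W ((hG t).finiteDimensional hW) hW).trans ?_
  rw [← hg]
  exact Finset.le_sup (f := g) (by simp [key])

end Index

end AcousticITP
end

/-! ### Fourier transform and the compact embedding into `L²`. -/

noncomputable section

namespace AcousticITP

open Complex MvPolynomial
open scoped FourierTransform

variable {n : ℕ}

theorem norm_toL2_sq (f : CS n) : ‖toL2 n f‖ ^ 2 = ∫ x, ‖f.1 x‖ ^ 2 := by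
  have h := inner_toL2 f f
  rw [inner_self_eq_norm_sq_to_K] at h
  have h2 : ∫ x, f.1 x * (starRingEnd ℂ) (f.1 x) = ((∫ x, ‖f.1 x‖ ^ 2 : ℝ) : ℂ) := by
    rw [← integral_complex_ofReal]
    refine integral_congr_ae (ae_of_all _ fun x => ?_)
    simp only [Complex.mul_conj, Complex.normSq_eq_norm_sq]
  rw [h2] at h
  refine Complex.ofReal_injective ?_
  rw [← h]
  push_cast
  rfl

/-- Smooth compactly supported functions as Schwartz functions. -/
def toSchwartz (f : CS n) : SchwartzMap (Rn n) ℂ :=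
  (hasCompactSupport_CS f).toSchwartzMap (contDiff_CS f)

theorem fourier_toSchwartz (f : CS n) (ξ : Rn n) : (𝓕 (toSchwartz f)) ξ = 𝓕 f.1 ξ := by
  rw [SchwartzMap.fourier_coe]; rfl

theorem integrable_norm_fourier_sq (f : CS n) : Integrable fun ξ => ‖𝓕 f.1 ξ‖ ^ 2 := by
  have h := ((𝓕 (toSchwartz f)).memLp 2 volume).integrable_norm_pow (by norm_num)
  simpa only [fourier_toSchwartz] using h

theorem integral_norm_fourier_sq (f : CS n) : ∫ ξ, ‖𝓕 f.1 ξ‖ ^ 2 = ‖toL2 n f‖ ^ 2 := by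
  rw [norm_toL2_sq]
  have h := SchwartzMap.integral_norm_sq_fourier (toSchwartz f)
  simp only [fourier_toSchwartz] at h
  exact h

/-- The kernel is `exp (-2πi ⟨x, ξ⟩)`, which is why symbols and weights are evaluated at `2π ξ`
below. -/
theorem fourier_Dl (j : Fin n) (f : CS n) (ξ : Rn n) :
    𝓕 (Dl j f).1 ξ = ((2 * Real.pi * ξ j : ℝ) : ℂ) * 𝓕 f.1 ξ := by
  have hint : Integrable f.1 :=
    (continuous_CS f).integrable_of_hasCompactSupport (hasCompactSupport_CS f)
  have hc : Continuous (fderiv ℝ f.1) := (contDiff_CS f).continuous_fderiv (by simp)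
  have hint' : Integrable (fderiv ℝ f.1) :=
    hc.integrable_of_hasCompactSupport ((hasCompactSupport_CS f).fderiv ℝ)
  have h := congrFun (Real.fourier_fderiv hint (differentiable_CS f) hint') ξ
  have h1 : 𝓕 (Dl j f).1 ξ = -I * (𝓕 (fderiv ℝ f.1) ξ) (EuclideanSpace.single j 1) := by
    rw [Real.fourier_eq, Real.fourier_eq, ContinuousLinearMap.integral_apply, ← integral_const_mul]
    · refine integral_congr_ae (ae_of_all _ fun x => ?_)
      simp only [Dl_apply, D, Circle.smul_def, smul_eq_mul, smul_apply]
      ring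
    · exact (Real.fourierIntegral_convergent_iff ξ).2 hint'
  rw [h1, h, VectorFourier.fourierSMulRight_apply]
  have h2 : (-innerSL ℝ : Rn n →L[ℝ] Rn n →L[ℝ] ℝ) ξ (EuclideanSpace.single j 1) = -ξ j := by
    change -(innerSL ℝ ξ (EuclideanSpace.single j 1)) = _
    rw [innerSL_apply_apply, EuclideanSpace.inner_single_right]
    simp
  simp only [h2, smul_eq_mul, Complex.real_smul]
  push_cast
  linear_combination (-2 * Real.pi * ξ j * 𝓕 f.1 ξ) * Complex.I_sq

theorem fourier_add_CS (f g : CS n) (ξ : Rn n) : 𝓕 (f + g).1 ξ = 𝓕 f.1 ξ + 𝓕 g.1 ξ := by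
  have h (f : CS n) : Integrable f.1 :=
    (continuous_CS f).integrable_of_hasCompactSupport (hasCompactSupport_CS f)
  exact congrFun (VectorFourier.fourierIntegral_add Real.continuous_fourierChar
    (L := innerₗ (Rn n)) continuous_inner (h f) (h g)) ξ

theorem fourier_smul_CS (c : ℂ) (f : CS n) (ξ : Rn n) : 𝓕 (c • f).1 ξ = c * 𝓕 f.1 ξ :=
  congrFun (VectorFourier.fourierIntegral_const_smul Real.fourierChar volume (innerₗ (Rn n)) f.1 c) ξ

theorem fourier_rho (Q : MvPolynomial (Fin n) ℂ) (f : CS n) (ξ : Rn n) :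
    𝓕 (rho n Q f).1 ξ = eval (fun j => ((2 * Real.pi * ξ j : ℝ) : ℂ)) Q * 𝓕 f.1 ξ := by
  induction Q using MvPolynomial.induction_on generalizing f with
  | C a =>
    rw [rho_C, LinearMap.smul_apply, fourier_smul_CS, eval_C]; rfl
  | add p q hp hq => rw [map_add, LinearMap.add_apply, fourier_add_CS, hp, hq, map_add, add_mul]
  | mul_X p k hp => rw [rho_mul_apply, rho_X, hp, fourier_Dl, map_mul, eval_X]; ring

theorem norm_fourier_rho_cx (P : MvPolynomial (Fin n) ℝ) (f : CS n) (ξ : Rn n) :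
    ‖𝓕 (rho n (cx P) f).1 ξ‖ ^ 2
      = (eval (fun j => ((2 * Real.pi) • ξ) j) P) ^ 2 * ‖𝓕 f.1 ξ‖ ^ 2 := by
  have : eval (fun j => ((2 * Real.pi * ξ j : ℝ) : ℂ)) (cx P)
      = ((eval (fun j => ((2 * Real.pi) • ξ) j) P : ℝ) : ℂ) := by
    rw [cx, eval_map]
    exact (eval₂_comp_left Complex.ofRealHom (RingHom.id ℝ) _ P).symm
  rw [fourier_rho, this, norm_mul, mul_pow, Complex.norm_real, Real.norm_eq_abs, sq_abs]

/-- Integration against `weight ²` of the Fourier transform. -/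
theorem exists_integral_weight_le {R : ℝ} (hR : 0 ≤ R) (P : MvPolynomial (Fin n) ℝ) :
    ∃ K, 0 ≤ K ∧ ∀ f : CS n, (∀ j, tsupport f.1 ⊆ {x | |x j| ≤ R}) →
      Integrable (fun ξ => weight P ((2 * Real.pi) • ξ) ^ 2 * ‖𝓕 f.1 ξ‖ ^ 2) ∧
      ∫ ξ, weight P ((2 * Real.pi) • ξ) ^ 2 * ‖𝓕 f.1 ξ‖ ^ 2
        ≤ K * ‖toL2 n (rho n (cx P) f)‖ ^ 2 := by
  choose K hK H using fun α => exists_norm_rho_polyDeriv_le hR P α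
  set A := Fintype.piFinset fun _ : Fin n => Finset.range (P.totalDegree + 1)
  refine ⟨∑ α ∈ A, K α ^ 2, by positivity, fun f hf => ?_⟩
  have he : (fun ξ => weight P ((2 * Real.pi) • ξ) ^ 2 * ‖𝓕 f.1 ξ‖ ^ 2)
      = fun ξ => ∑ α ∈ A, ‖𝓕 (rho n (cx (polyDeriv α P)) f).1 ξ‖ ^ 2 := by
    ext ξ
    rw [weight, Real.sq_sqrt (by positivity), Finset.sum_mul]
    exact Finset.sum_congr rfl fun α _ => (norm_fourier_rho_cx _ f ξ).symm
  rw [he]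
  refine ⟨integrable_finsetSum _ fun α _ => integrable_norm_fourier_sq _, ?_⟩
  rw [integral_finsetSum _ fun α _ => integrable_norm_fourier_sq _, Finset.sum_mul]
  refine Finset.sum_le_sum fun α _ => ?_
  rw [integral_norm_fourier_sq, ← mul_pow]
  exact pow_le_pow_left₀ (norm_nonneg _) (H α f hf) 2

/-- The exponential `x ↦ exp (2π i ⟨x, ξ⟩)` cut off to `Ω`. -/
def expCut (Ω : Set (Rn n)) (ξ : Rn n) : Rn n → ℂ :=
  Ω.indicator fun x => Complex.exp (I * ((2 * Real.pi * inner ℝ x ξ : ℝ) : ℂ))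

theorem memLp_expCut {Ω : Set (Rn n)} (hΩ : MeasurableSet Ω) (hb : Bornology.IsBounded Ω)
    (ξ : Rn n) : MemLp (expCut Ω ξ) 2 volume := by
  rw [expCut, memLp_indicator_iff_restrict hΩ]
  have : IsFiniteMeasure ((volume : Measure (Rn n)).restrict Ω) :=
    ⟨by simpa using hb.measure_lt_top⟩
  refine MemLp.of_bound (by fun_prop) 1 (ae_of_all _ fun x => ?_)
  rw [Complex.norm_exp_I_mul_ofReal]

theorem continuous_expCut {Ω : Set (Rn n)} (hΩ : MeasurableSet Ω) (hb : Bornology.IsBounded Ω) :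
    Continuous fun ξ => (memLp_expCut hΩ hb ξ).toLp := by
  obtain ⟨R, hR, hsub⟩ := hb.subset_closedBall_lt 0 0
  have hfin : volume Ω ≠ ∞ := hb.measure_lt_top.ne
  set one : Lp ℂ 2 (volume : Measure (Rn n)) := indicatorConstLp 2 hΩ hfin 1
  have hL : LipschitzWith (Real.toNNReal (2 * Real.pi * R * ‖one‖))
      fun ξ => (memLp_expCut hΩ hb ξ).toLp := by
    refine LipschitzWith.of_dist_le_mul fun ξ ζ => ?_
    rw [dist_eq_norm, dist_eq_norm, Real.coe_toNNReal _ (by positivity),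
      ← MemLp.toLp_sub]
    have : ‖((memLp_expCut hΩ hb ξ).sub (memLp_expCut hΩ hb ζ)).toLp‖
        ≤ (2 * Real.pi * R * ‖ξ - ζ‖) * ‖one‖ := by
      refine Lp.norm_le_mul_norm_of_ae_le_mul ?_
      filter_upwards [((memLp_expCut hΩ hb ξ).sub (memLp_expCut hΩ hb ζ)).coeFn_toLp,
        indicatorConstLp_coeFn (p := 2) (hs := hΩ) (hμs := hfin) (c := (1 : ℂ))] with x h1 h2
      rw [h1, h2]
      by_cases hx : x ∈ Ω
      · simp only [Pi.sub_apply, expCut, Set.indicator_of_mem hx, norm_one, mul_one]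
        have hxR : ‖x‖ ≤ R := by simpa using hsub hx
        have e : Complex.exp (I * ((2 * Real.pi * inner ℝ x ξ : ℝ) : ℂ))
            - Complex.exp (I * ((2 * Real.pi * inner ℝ x ζ : ℝ) : ℂ))
            = Complex.exp (I * ((2 * Real.pi * inner ℝ x ζ : ℝ) : ℂ))
              * (Complex.exp (I * ((2 * Real.pi * inner ℝ x (ξ - ζ) : ℝ) : ℂ)) - 1) := by
          rw [mul_sub, mul_one, ← Complex.exp_add]
          congr 2
          rw [inner_sub_right]; push_cast; ring
        rw [e, norm_mul, Complex.norm_exp_I_mul_ofReal, one_mul]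
        refine Real.norm_exp_I_mul_ofReal_sub_one_le.trans ?_
        rw [Real.norm_eq_abs, abs_mul, abs_of_nonneg (by positivity : 0 ≤ 2 * Real.pi)]
        rw [mul_assoc _ R]
        gcongr
        refine (abs_real_inner_le_norm _ _).trans ?_
        gcongr
      · simp [expCut, hx]
    refine this.trans (le_of_eq (by ring))
  exact hL.continuous

theorem inner_expCut {Ω : Set (Rn n)} (hΩ : MeasurableSet Ω) (hb : Bornology.IsBounded Ω)
    (ξ : Rn n) (f : CS n) (hf : tsupport f.1 ⊆ Ω) :
    inner ℂ (memLp_expCut hΩ hb ξ).toLp (toL2 n f) = 𝓕 f.1 ξ := by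
  rw [L2.inner_def, Real.fourier_eq']
  refine integral_congr_ae ?_
  filter_upwards [(memLp_expCut hΩ hb ξ).coeFn_toLp, coeFn_toL2 f] with x h1 h2
  rw [h1, h2, smul_eq_mul]
  by_cases hx : x ∈ Ω
  · simp only [expCut, Set.indicator_of_mem hx, RCLike.inner_apply]
    rw [← Complex.exp_conj, mul_comm]
    congr 2
    simp only [map_mul, Complex.conj_I, Complex.conj_ofReal]
    push_cast
    ring
  · have : f.1 x = 0 := by
      by_contra h
      exact hx (hf (subset_tsupport _ h))
    simp [this]

/-- On low frequencies `𝓕 f ξ` is the inner product of `f` with an exponential cut off to `Ω`. These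
exponentials depend continuously on `ξ` in `L²`, so over a closed ball they form a compact set; the
`g i` are a finite `δ`-net of it. -/
theorem setIntegral_norm_fourier_sq_le {Ω : Set (Rn n)} (hΩ : MeasurableSet Ω)
    (hb : Bornology.IsBounded Ω) (T δ : ℝ) (hδ : 0 < δ) :
    ∃ (M : ℕ) (g : Fin M → Lp ℂ 2 (volume : Measure (Rn n))), ∀ f : CS n, tsupport f.1 ⊆ Ω →
      ∫ ξ in Metric.closedBall 0 T, ‖𝓕 f.1 ξ‖ ^ 2
        ≤ volume.real (Metric.closedBall (0 : Rn n) T)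
          * (2 * ∑ i, ‖inner ℂ (g i) (toL2 n f)‖ ^ 2 + 2 * δ ^ 2 * ‖toL2 n f‖ ^ 2) := by
  have hcomp : IsCompact ((fun ξ => (memLp_expCut hΩ hb ξ).toLp) '' Metric.closedBall 0 T) :=
    (isCompact_closedBall 0 T).image (continuous_expCut hΩ hb)
  obtain ⟨t, -, htfin, ht⟩ := Metric.totallyBounded_iff.1 hcomp.totallyBounded δ hδ |>.imp
    fun t h => (⟨trivial, h.1, h.2⟩ : True ∧ t.Finite ∧ _)
  let e := htfin.toFinset.equivFin
  refine ⟨htfin.toFinset.card, fun i => (e.symm i : Lp ℂ 2 (volume : Measure (Rn n))),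
    fun f hf => ?_⟩
  set c := 2 * ∑ i, ‖inner ℂ ((e.symm i : Lp ℂ 2 (volume : Measure (Rn n)))) (toL2 n f)‖ ^ 2
    + 2 * δ ^ 2 * ‖toL2 n f‖ ^ 2 with hc
  have hpt : ∀ ξ ∈ Metric.closedBall (0 : Rn n) T, ‖𝓕 f.1 ξ‖ ^ 2 ≤ c := by
    intro ξ hξ
    obtain ⟨y, hy, hyd⟩ := Set.mem_iUnion₂.1 (ht ⟨ξ, hξ, rfl⟩)
    rw [Metric.mem_ball, dist_eq_norm] at hyd
    rw [← inner_expCut hΩ hb ξ f hf]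
    set G := (memLp_expCut hΩ hb ξ).toLp
    have h1 : ‖inner ℂ G (toL2 n f)‖ ≤ ‖inner ℂ y (toL2 n f)‖ + δ * ‖toL2 n f‖ := by
      have : inner ℂ G (toL2 n f) = inner ℂ y (toL2 n f) + inner ℂ (G - y) (toL2 n f) := by
        rw [← inner_add_left, add_sub_cancel]
      rw [this]
      refine (norm_add_le _ _).trans (add_le_add le_rfl ((norm_inner_le_norm _ _).trans ?_))
      gcongr
    have h2 : ‖inner ℂ y (toL2 n f)‖ ^ 2
        ≤ ∑ i, ‖inner ℂ ((e.symm i : Lp ℂ 2 (volume : Measure (Rn n)))) (toL2 n f)‖ ^ 2 := by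
      have := Finset.single_le_sum (s := Finset.univ)
        (f := fun i => ‖inner ℂ ((e.symm i : Lp ℂ 2 (volume : Measure (Rn n)))) (toL2 n f)‖ ^ 2)
        (fun _ _ => by positivity) (Finset.mem_univ (e ⟨y, by simpa using hy⟩))
      simpa using this
    have h3 := pow_le_pow_left₀ (norm_nonneg _) h1 2
    have h4 := sq_nonneg (‖inner ℂ y (toL2 n f)‖ - δ * ‖toL2 n f‖)
    rw [hc]
    nlinarith
  have hfin : volume (Metric.closedBall (0 : Rn n) T) < ∞ := measure_closedBall_lt_top
  calc ∫ ξ in Metric.closedBall 0 T, ‖𝓕 f.1 ξ‖ ^ 2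
      ≤ ∫ ξ in Metric.closedBall (0 : Rn n) T, c :=
        setIntegral_mono_on (integrable_norm_fourier_sq f).integrableOn
          (integrableOn_const hfin.ne) measurableSet_closedBall hpt
    _ = _ := by rw [setIntegral_const, smul_eq_mul]

/-- Compactness of the embedding of `H^P_0(Ω)` in `L²`, on test functions. -/
theorem exists_finite_rank_le (P : MvPolynomial (Fin n) ℝ)
    (hP : Tendsto (weight P) (cocompact (Rn n)) atTop) {Ω : Set (Rn n)} (hΩ : MeasurableSet Ω)
    (hb : Bornology.IsBounded Ω) {η : ℝ} (hη : 0 < η) :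
    ∃ (M : ℕ) (g : Fin M → Lp ℂ 2 (volume : Measure (Rn n))), ∀ f : CS n, tsupport f.1 ⊆ Ω →
      ‖toL2 n f‖ ^ 2 ≤ η * ‖toL2 n (rho n (cx P) f)‖ ^ 2
        + ∑ i, ‖inner ℂ (g i) (toL2 n f)‖ ^ 2 := by
  obtain ⟨R, hR, hsub⟩ := hb.subset_closedBall_lt 0 0
  obtain ⟨K, hK, hw⟩ := exists_integral_weight_le hR.le P
  -- Chosen so that `K / S ≤ η / 2`: the frequencies with weight squared at least `S` then
  -- contribute at most `η / 2 * ‖P(D) f‖²`.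
  set S : ℝ := 2 * K / η + 1 with hS
  have hSpos : 0 < S := by positivity
  obtain ⟨T₀, hT₀⟩ := Metric.closedBall_compl_subset_of_mem_cocompact
    (hP.eventually_ge_atTop (Real.sqrt S)) 0
  set T := |T₀|
  have htail : ∀ ξ : Rn n, ξ ∉ Metric.closedBall (0 : Rn n) T →
      S ≤ weight P ((2 * Real.pi) • ξ) ^ 2 := by
    intro ξ hξ
    have h1 : (2 * Real.pi) • ξ ∈ (Metric.closedBall (0 : Rn n) T₀)ᶜ := by
      rw [Set.mem_compl_iff, mem_closedBall_zero_iff, not_le] at *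
      rw [norm_smul, Real.norm_of_nonneg (by positivity)]
      have : 1 ≤ 2 * Real.pi := by linarith [Real.pi_gt_three]
      calc T₀ ≤ T := le_abs_self _
        _ < ‖ξ‖ := by simpa using hξ
        _ ≤ _ := le_mul_of_one_le_left (norm_nonneg _) this
    have h2 : Real.sqrt S ≤ weight P ((2 * Real.pi) • ξ) := hT₀ h1
    calc S = Real.sqrt S ^ 2 := (Real.sq_sqrt hSpos.le).symm
      _ ≤ _ := pow_le_pow_left₀ (Real.sqrt_nonneg _) h2 2
  set v := volume.real (Metric.closedBall (0 : Rn n) T)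
  have hv : 0 ≤ v := measureReal_nonneg
  -- Gives `2 v δ² ≤ 1/2`, so the net error is absorbed in half of `‖f‖²`; the resulting doubling
  -- explains the factor `4 v` in the functionals.
  set δ := Real.sqrt (1 / (4 * (v + 1)))
  have hδ : 0 < δ := Real.sqrt_pos.2 (by positivity)
  have hδ2 : δ ^ 2 = 1 / (4 * (v + 1)) := Real.sq_sqrt (by positivity)
  obtain ⟨M, g, hg⟩ := setIntegral_norm_fourier_sq_le hΩ hb T δ hδ
  refine ⟨M, fun i => ((Real.sqrt (4 * v) : ℝ) : ℂ) • g i, fun f hf => ?_⟩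
  have hf' : ∀ j, tsupport f.1 ⊆ {x | |x j| ≤ R} := fun j x hx => by
    have hxR : ‖x‖ ≤ R := by simpa using hsub (hf hx)
    exact (PiLp.norm_apply_le x j).trans hxR
  obtain ⟨hwi, hwf⟩ := hw f hf'
  have h1 := hg f hf
  have h2 : ∫ ξ in (Metric.closedBall (0 : Rn n) T)ᶜ, ‖𝓕 f.1 ξ‖ ^ 2
      ≤ S⁻¹ * (K * ‖toL2 n (rho n (cx P) f)‖ ^ 2) := by
    calc ∫ ξ in (Metric.closedBall (0 : Rn n) T)ᶜ, ‖𝓕 f.1 ξ‖ ^ 2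
        ≤ ∫ ξ in (Metric.closedBall (0 : Rn n) T)ᶜ,
            S⁻¹ * (weight P ((2 * Real.pi) • ξ) ^ 2 * ‖𝓕 f.1 ξ‖ ^ 2) := by
          refine setIntegral_mono_on (integrable_norm_fourier_sq f).integrableOn
            (hwi.const_mul _).integrableOn measurableSet_closedBall.compl fun ξ hξ => ?_
          rw [← mul_assoc]
          refine le_mul_of_one_le_left (by positivity) ?_
          rw [inv_mul_eq_div, one_le_div hSpos]
          exact htail ξ hξ
      _ ≤ ∫ ξ, S⁻¹ * (weight P ((2 * Real.pi) • ξ) ^ 2 * ‖𝓕 f.1 ξ‖ ^ 2) :=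
          setIntegral_le_integral (hwi.const_mul _) (ae_of_all _ fun ξ => by positivity)
      _ ≤ _ := by
          rw [integral_const_mul]
          gcongr
  have h3 := integral_add_compl (measurableSet_closedBall (x := (0 : Rn n)) (ε := T))
    (integrable_norm_fourier_sq f)
  rw [integral_norm_fourier_sq] at h3
  have h4 : ∀ i, ‖inner ℂ (((Real.sqrt (4 * v) : ℝ) : ℂ) • g i) (toL2 n f)‖ ^ 2
      = 4 * v * ‖inner ℂ (g i) (toL2 n f)‖ ^ 2 := by
    intro i
    rw [inner_smul_left, Complex.conj_ofReal, norm_mul, Complex.norm_real, mul_pow,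
      Real.norm_of_nonneg (Real.sqrt_nonneg _), Real.sq_sqrt (by positivity)]
  simp only [h4]
  rw [← Finset.mul_sum]
  set s := ∑ i, ‖inner ℂ (g i) (toL2 n f)‖ ^ 2
  have h5 : v * (2 * δ ^ 2 * ‖toL2 n f‖ ^ 2) ≤ 1 / 2 * ‖toL2 n f‖ ^ 2 := by
    rw [← mul_assoc]
    refine mul_le_mul_of_nonneg_right ?_ (by positivity)
    rw [hδ2]
    field_simp
    linarith
  have h6 : S⁻¹ * (K * ‖toL2 n (rho n (cx P) f)‖ ^ 2)
      ≤ η / 2 * ‖toL2 n (rho n (cx P) f)‖ ^ 2 := by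
    rw [← mul_assoc]
    refine mul_le_mul_of_nonneg_right ?_ (by positivity)
    rw [inv_mul_le_iff₀ hSpos, hS]
    field_simp
    linarith
  nlinarith

end AcousticITP
end

/-! ### The Hilbert space `H^P_0(Ω)` as a closed graph, and unique continuation. -/

noncomputable section

namespace AcousticITP

open Complex

variable {n : ℕ}

/-- Square integrable functions on `ℝⁿ`. -/
abbrev E2 (n : ℕ) : Type := Lp ℂ 2 (volume : Measure (Rn n))

/-- Multiplication by a bounded measurable function on `L²`. -/
def mulL (m : Rn n → ℂ) (hm : MemLp m ∞ volume) : E2 n →L[ℂ] E2 n :=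
  (ContinuousLinearMap.mul ℂ ℂ).holderL volume ∞ 2 2 hm.toLp

theorem coeFn_mulL (m : Rn n → ℂ) (hm : MemLp m ∞ volume) (f : E2 n) :
    mulL m hm f =ᵐ[volume] fun x => m x * f x := by
  filter_upwards [(ContinuousLinearMap.mul ℂ ℂ).coeFn_holder (r := 2) hm.toLp f, hm.coeFn_toLp]
    with x h1 h2
  rw [mulL, ContinuousLinearMap.holderL_apply_apply, h1, h2]
  rfl

/-- The smooth functions with compact support in `Ω`. -/
def CSin (Ω : Set (Rn n)) : Submodule ℂ (CS n) where
  carrier := {f | tsupport f.1 ⊆ Ω}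
  add_mem' := fun {f g} hf hg => (tsupport_add f.1 g.1).trans (Set.union_subset hf hg)
  zero_mem' := by simp
  smul_mem' := fun c f hf => (tsupport_smul_subset_right (fun _ => c) f.1).trans hf

/-- The graph map `φ ↦ (φ, P(D) φ)`. -/
def graphMap (P : MvPolynomial (Fin n) ℝ) : CS n →ₗ[ℂ] WithLp 2 (E2 n × E2 n) :=
  (WithLp.linearEquiv 2 ℂ (E2 n × E2 n)).symm.toLinearMap.comp
    ((toL2 n).prod ((toL2 n).comp (rho n (cx P))))

/-- The closure of the graph of `P(D)` on test functions in `Ω`. -/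
def H0 (P : MvPolynomial (Fin n) ℝ) (Ω : Set (Rn n)) : Submodule ℂ (WithLp 2 (E2 n × E2 n)) :=
  ((CSin Ω).map (graphMap P)).topologicalClosure

instance (P : MvPolynomial (Fin n) ℝ) (Ω : Set (Rn n)) : CompleteSpace (H0 P Ω) :=
  (Submodule.isClosed_topologicalClosure _).completeSpace_coe

theorem H0_induction {P : MvPolynomial (Fin n) ℝ} {Ω : Set (Rn n)}
    {p : WithLp 2 (E2 n × E2 n) → Prop} (hp : IsClosed {w | p w})
    (h : ∀ f : CS n, tsupport f.1 ⊆ Ω → p (graphMap P f)) (u : H0 P Ω) : p u.1 := by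
  have : closure (((CSin Ω).map (graphMap P) : Submodule ℂ _) : Set _) ⊆ {w | p w} := by
    refine closure_minimal ?_ hp
    rintro _ ⟨f, hf, rfl⟩
    exact h f hf
  exact this u.2

/-- The function underlying an element of `H^P_0(Ω)`. -/
def fnL (P : MvPolynomial (Fin n) ℝ) (Ω : Set (Rn n)) : H0 P Ω →L[ℂ] E2 n :=
  (WithLp.fstL 2 ℂ (E2 n) (E2 n)).comp (H0 P Ω).subtypeL

/-- `P(D)` on `H^P_0(Ω)`. -/
def opL (P : MvPolynomial (Fin n) ℝ) (Ω : Set (Rn n)) : H0 P Ω →L[ℂ] E2 n :=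
  (WithLp.sndL 2 ℂ (E2 n) (E2 n)).comp (H0 P Ω).subtypeL

variable {P : MvPolynomial (Fin n) ℝ} {Ω : Set (Rn n)}

theorem H0_norm_sq (u : H0 P Ω) : ‖u‖ ^ 2 = ‖fnL P Ω u‖ ^ 2 + ‖opL P Ω u‖ ^ 2 :=
  WithLp.prod_norm_sq_eq_of_L2 u.1

theorem H0_ext {u v : H0 P Ω} (h1 : fnL P Ω u = fnL P Ω v) (h2 : opL P Ω u = opL P Ω v) :
    u = v := by
  refine sub_eq_zero.1 (norm_eq_zero.1 ?_)
  have := H0_norm_sq (u - v)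
  rw [map_sub, map_sub, h1, h2] at this
  simpa using this

/-- A test function as an element of `H^P_0(Ω)`. -/
def testH0 (P : MvPolynomial (Fin n) ℝ) (f : CS n) (hf : tsupport f.1 ⊆ Ω) : H0 P Ω :=
  ⟨graphMap P f, Submodule.le_topologicalClosure _ ⟨f, hf, rfl⟩⟩

theorem fnL_testH0 (f : CS n) (hf : tsupport f.1 ⊆ Ω) : fnL P Ω (testH0 P f hf) = toL2 n f := rfl

theorem opL_testH0 (f : CS n) (hf : tsupport f.1 ⊆ Ω) :
    opL P Ω (testH0 P f hf) = toL2 n (rho n (cx P) f) := rfl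

/-- Closed conditions on `(u, P(D) u)` pass from test functions to `H^P_0(Ω)`. -/
theorem H0_induction' {p : E2 n → E2 n → Prop} (hp : IsClosed {w : E2 n × E2 n | p w.1 w.2})
    (h : ∀ f : CS n, tsupport f.1 ⊆ Ω → p (toL2 n f) (toL2 n (rho n (cx P) f))) (u : H0 P Ω) :
    p (fnL P Ω u) (opL P Ω u) :=
  H0_induction (p := fun w => p (WithLp.fstL 2 ℂ (E2 n) (E2 n) w) (WithLp.sndL 2 ℂ (E2 n) (E2 n) w))
    (hp.preimage ((WithLp.fstL 2 ℂ (E2 n) (E2 n)).continuous.prodMk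
      (WithLp.sndL 2 ℂ (E2 n) (E2 n)).continuous)) h u

/-- Symmetry of `P(D)` on test functions, extended by density in one variable at a time. -/
theorem inner_opL (u v : H0 P Ω) :
    inner ℂ (opL P Ω u) (fnL P Ω v) = inner ℂ (fnL P Ω u) (opL P Ω v) := by
  refine H0_induction' (p := fun a b => inner ℂ b (fnL P Ω v) = inner ℂ a (opL P Ω v))
    (isClosed_eq (by fun_prop) (by fun_prop)) (fun f _ => ?_) u
  refine H0_induction' (p := fun a b => inner ℂ (toL2 n (rho n (cx P) f)) a
    = inner ℂ (toL2 n f) b) (isClosed_eq (by fun_prop) (by fun_prop)) (fun g _ => ?_) v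
  exact inner_rho_cx P f g

theorem isClosed_ae_eq_zero (s : Set (Rn n)) :
    IsClosed {f : E2 n | f =ᵐ[volume.restrict s] 0} := by
  have : {f : E2 n | f =ᵐ[volume.restrict s] 0}
      = {f | LpToLpRestrictCLM (Rn n) ℂ ℂ volume 2 s f = 0} := by
    ext f
    rw [Set.mem_ofPred_eq, Set.mem_ofPred_eq, Lp.eq_zero_iff_ae_eq_zero]
    have h := LpToLpRestrictCLM_coeFn ℂ s f
    exact ⟨fun h' => h.trans h', fun h' => h.symm.trans h'⟩
  rw [this]
  exact isClosed_eq (ContinuousLinearMap.continuous _) continuous_const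

theorem toL2_ae_eq_zero (hΩ : MeasurableSet Ω) {f : CS n} (hf : tsupport f.1 ⊆ Ω) :
    toL2 n f =ᵐ[volume.restrict Ωᶜ] 0 := by
  filter_upwards [ae_restrict_of_ae (coeFn_toL2 f), ae_restrict_mem hΩ.compl] with x hx hxΩ
  rw [hx]
  by_contra h
  exact hxΩ (hf (subset_tsupport _ h))

theorem fnL_ae_eq_zero (hΩ : MeasurableSet Ω) (u : H0 P Ω) :
    fnL P Ω u =ᵐ[volume.restrict Ωᶜ] 0 :=
  H0_induction' (p := fun a _ => a =ᵐ[volume.restrict Ωᶜ] 0)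
    ((isClosed_ae_eq_zero Ωᶜ).preimage continuous_fst) (fun _ hf => toL2_ae_eq_zero hΩ hf) u

theorem opL_ae_eq_zero (hΩ : MeasurableSet Ω) (u : H0 P Ω) :
    opL P Ω u =ᵐ[volume.restrict Ωᶜ] 0 :=
  H0_induction' (p := fun _ b => b =ᵐ[volume.restrict Ωᶜ] 0)
    ((isClosed_ae_eq_zero Ωᶜ).preimage continuous_snd)
    (fun f hf => toL2_ae_eq_zero hΩ ((tsupport_rho_subset _ f).trans hf)) u

theorem exists_finite_rank_le_H0 (hP : Tendsto (weight P) (cocompact (Rn n)) atTop)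
    (hΩ : MeasurableSet Ω) (hb : Bornology.IsBounded Ω) {η : ℝ} (hη : 0 < η) :
    ∃ (M : ℕ) (g : Fin M → E2 n), ∀ u : H0 P Ω,
      ‖fnL P Ω u‖ ^ 2 ≤ η * ‖opL P Ω u‖ ^ 2 + ∑ i, ‖inner ℂ (g i) (fnL P Ω u)‖ ^ 2 := by
  obtain ⟨M, g, hg⟩ := exists_finite_rank_le P hP hΩ hb hη
  refine ⟨M, g, fun u => H0_induction' (p := fun a b => ‖a‖ ^ 2 ≤ η * ‖b‖ ^ 2
    + ∑ i, ‖inner ℂ (g i) a‖ ^ 2) (isClosed_le (by fun_prop) (by fun_prop)) hg u⟩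

/-- Weak unique continuation: an element of `H^P_0(Ω)` with `|P(D) u| ≤ K |u|` vanishes. -/
theorem eq_zero_of_norm_opL_le (hdeg : P.totalDegree ≠ 0) (hΩ : MeasurableSet Ω)
    (hb : Bornology.IsBounded Ω) (u : H0 P Ω) (K : ℝ)
    (h : ∀ᵐ x ∂volume.restrict Ω, ‖opL P Ω u x‖ ≤ K * ‖fnL P Ω u x‖) : u = 0 := by
  obtain ⟨R, hR, hsub⟩ := hb.subset_closedBall_lt 0 0
  obtain ⟨j, c, hc, H⟩ := exists_carleman hR.le P hdeg
  have hcoord : ∀ x ∈ Ω, ∀ i, |x i| ≤ R := fun x hx i => by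
    have hxR : ‖x‖ ≤ R := by simpa using hsub hx
    exact (PiLp.norm_apply_le x i).trans hxR
  -- Makes the Carleman constant `c |τ| = |K| + 1` strictly larger than `K`, so the two estimates
  -- for the weighted norms contradict each other unless both norms vanish.
  set τ : ℝ := (|K| + 1) / c
  have hτ : 0 < τ := by positivity
  -- Cutting the weight off to the bounded set `Ω` makes multiplication by it bounded on `L²`, so
  -- the Carleman inequality passes to the closure.
  set m : Rn n → ℂ := Ω.indicator fun x => Complex.exp (τ * (x j : ℝ))
  have hm : MemLp m ∞ volume := by
    rw [memLp_indicator_iff_restrict hΩ]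
    refine memLp_top_of_bound
      (contDiff_expw τ j).continuous.aestronglyMeasurable (Real.exp (τ * R)) ?_
    filter_upwards [ae_restrict_mem hΩ] with x hx
    rw [← Complex.ofReal_mul, Complex.norm_exp_ofReal]
    gcongr
    exact (le_abs_self _).trans (hcoord x hx j)
  have hmE : ∀ f : CS n, tsupport f.1 ⊆ Ω → mulL m hm (toL2 n f) = toL2 n (El τ j f) := by
    intro f hf
    refine Lp.ext ?_
    filter_upwards [coeFn_mulL m hm (toL2 n f), coeFn_toL2 f, coeFn_toL2 (El τ j f)]
      with x h1 h2 h3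
    rw [h1, h2, h3]
    by_cases hx : x ∈ Ω
    · simp only [m, Set.indicator_of_mem hx]; rfl
    · have : f.1 x = 0 := by
        by_contra h
        exact hx (hf (subset_tsupport _ h))
      change _ = _ * f.1 x
      rw [this, mul_zero, mul_zero]
  have hcarl : c * |τ| * ‖mulL m hm (fnL P Ω u)‖ ≤ ‖mulL m hm (opL P Ω u)‖ := by
    refine H0_induction' (p := fun a b => c * |τ| * ‖mulL m hm a‖ ≤ ‖mulL m hm b‖)
      (isClosed_le (by fun_prop) (by fun_prop)) (fun f hf => ?_) u
    rw [hmE f hf, hmE _ ((tsupport_rho_subset _ f).trans hf)]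
    exact H τ f fun i x hx => hcoord x (hf hx) i
  have hu0 := fnL_ae_eq_zero hΩ u
  have hop0 := opL_ae_eq_zero hΩ u
  have hglob : ∀ᵐ x : Rn n, ‖opL P Ω u x‖ ≤ K * ‖fnL P Ω u x‖ := by
    refine ae_of_ae_restrict_of_ae_restrict_compl Ω h ?_
    filter_upwards [hu0, hop0] with x h1 h2
    rw [h1, h2]; simp
  have hle : ‖mulL m hm (opL P Ω u)‖ ≤ K * ‖mulL m hm (fnL P Ω u)‖ := by
    refine Lp.norm_le_mul_norm_of_ae_le_mul ?_
    filter_upwards [hglob, coeFn_mulL m hm (opL P Ω u), coeFn_mulL m hm (fnL P Ω u)] with x h1 h2 h3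
    rw [h2, h3, norm_mul, norm_mul, mul_left_comm]
    gcongr
  have hcτ : c * |τ| = |K| + 1 := by
    rw [abs_of_pos hτ]; simp only [τ]; field_simp
  rw [hcτ] at hcarl
  have hz : ‖mulL m hm (fnL P Ω u)‖ = 0 := by
    have := norm_nonneg (mulL m hm (fnL P Ω u))
    nlinarith [le_abs_self K]
  have hfn : fnL P Ω u = 0 := by
    rw [Lp.eq_zero_iff_ae_eq_zero]
    refine ae_of_ae_restrict_of_ae_restrict_compl Ω ?_ hu0
    have h1 := (Lp.eq_zero_iff_ae_eq_zero).1 (norm_eq_zero.1 hz)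
    filter_upwards [ae_restrict_of_ae h1, ae_restrict_of_ae (coeFn_mulL m hm (fnL P Ω u)),
      ae_restrict_mem hΩ] with x h2 h3 hx
    rw [h3] at h2
    simpa [m, hx] using h2
  have hop : opL P Ω u = 0 := by
    rw [Lp.eq_zero_iff_ae_eq_zero]
    rw [Lp.eq_zero_iff_ae_eq_zero] at hfn
    filter_upwards [hglob, hfn] with x h1 h2
    rw [h2] at h1
    simpa using h1
  exact H0_ext (by rw [hfn, map_zero]) (by rw [hop, map_zero])

end AcousticITP
end

/-! ### The self-adjoint family `transOp` and its coercivity. -/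

noncomputable section

namespace AcousticITP

open Complex

variable {n : ℕ} {P : MvPolynomial (Fin n) ℝ} {Ω : Set (Rn n)}

theorem inner_mulL_symm (m : Rn n → ℝ) (hm : MemLp (fun x => (m x : ℂ)) ∞ volume) (f g : E2 n) :
    inner ℂ (mulL _ hm f) g = inner ℂ f (mulL _ hm g) := by
  rw [L2.inner_def, L2.inner_def]
  refine integral_congr_ae ?_
  filter_upwards [coeFn_mulL _ hm f, coeFn_mulL _ hm g] with x h1 h2
  rw [h1, h2]
  simp only [RCLike.inner_apply, map_mul, Complex.conj_ofReal]
  ring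

theorem norm_sq_eq_integral (f : E2 n) : ‖f‖ ^ 2 = ∫ x, ‖f x‖ ^ 2 := by
  rw [← inner_self_eq_norm_sq (𝕜 := ℂ), L2.inner_def, ← integral_re (L2.integrable_inner f f)]
  refine integral_congr_ae (ae_of_all _ fun x => ?_)
  exact inner_self_eq_norm_sq (𝕜 := ℂ) (f x)

theorem re_inner_mulL_ae (m : Rn n → ℝ) (hm : MemLp (fun x => (m x : ℂ)) ∞ volume) (f : E2 n) :
    (fun x => RCLike.re (inner ℂ (mulL _ hm f x) (f x))) =ᵐ[volume] fun x => m x * ‖f x‖ ^ 2 := by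
  filter_upwards [coeFn_mulL _ hm f] with x h
  rw [h, ← smul_eq_mul, inner_smul_left, Complex.conj_ofReal, inner_self_eq_norm_sq_to_K]
  change ((m x : ℂ) * ((‖f x‖ : ℝ) : ℂ) ^ 2).re = _
  rw [← Complex.ofReal_pow, ← Complex.ofReal_mul, Complex.ofReal_re]

theorem integrable_mul_norm_sq (m : Rn n → ℝ) (hm : MemLp (fun x => (m x : ℂ)) ∞ volume)
    (f : E2 n) : Integrable fun x => m x * ‖f x‖ ^ 2 :=
  (L2.integrable_inner (𝕜 := ℂ) (mulL _ hm f) f).re.congr (re_inner_mulL_ae m hm f)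

theorem re_inner_mulL (m : Rn n → ℝ) (hm : MemLp (fun x => (m x : ℂ)) ∞ volume) (f : E2 n) :
    RCLike.re (inner ℂ (mulL _ hm f) f) = ∫ x, m x * ‖f x‖ ^ 2 := by
  rw [L2.inner_def, ← integral_re (L2.integrable_inner _ _)]
  exact integral_congr_ae (re_inner_mulL_ae m hm f)

theorem integrable_norm_sq (f : E2 n) : Integrable fun x => ‖f x‖ ^ 2 := by
  have := (L2.integrable_inner (𝕜 := ℂ) f f).re
  refine this.congr (ae_of_all _ fun x => ?_)
  exact inner_self_eq_norm_sq (𝕜 := ℂ) (f x)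

theorem le_re_inner_mulL {m : Rn n → ℝ}
    (hm : MemLp (fun x => (m x : ℂ)) ∞ volume) {κ : ℝ}
    (hκ : ∀ᵐ x ∂volume.restrict Ω, κ ≤ m x) {f : E2 n} (hf : f =ᵐ[volume.restrict Ωᶜ] 0) :
    κ * ‖f‖ ^ 2 ≤ RCLike.re (inner ℂ (mulL _ hm f) f) := by
  rw [re_inner_mulL, norm_sq_eq_integral, ← integral_const_mul]
  refine integral_mono_ae ((integrable_norm_sq f).const_mul κ) (integrable_mul_norm_sq m hm f) ?_
  refine ae_of_ae_restrict_of_ae_restrict_compl Ω ?_ ?_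
  · filter_upwards [hκ] with x hx
    gcongr
  · filter_upwards [hf] with x hx
    rw [hx]; simp

theorem re_inner_mulL_le {m : Rn n → ℝ}
    (hm : MemLp (fun x => (m x : ℂ)) ∞ volume) {κ : ℝ}
    (hκ : ∀ᵐ x ∂volume.restrict Ω, m x ≤ κ) {f : E2 n} (hf : f =ᵐ[volume.restrict Ωᶜ] 0) :
    RCLike.re (inner ℂ (mulL _ hm f) f) ≤ κ * ‖f‖ ^ 2 := by
  rw [re_inner_mulL, norm_sq_eq_integral, ← integral_const_mul]
  refine integral_mono_ae (integrable_mul_norm_sq m hm f) ((integrable_norm_sq f).const_mul κ) ?_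
  refine ae_of_ae_restrict_of_ae_restrict_compl Ω ?_ ?_
  · filter_upwards [hκ] with x hx
    gcongr
  · filter_upwards [hf] with x hx
    rw [hx]; simp

/-- `P(D) - t` on `H^P_0(Ω)`. -/
def shiftL (P : MvPolynomial (Fin n) ℝ) (Ω : Set (Rn n)) (t : ℝ) : H0 P Ω →L[ℂ] E2 n :=
  opL P Ω - (t : ℂ) • fnL P Ω

theorem shiftL_apply (t : ℝ) (u : H0 P Ω) :
    shiftL P Ω t u = opL P Ω u - (t : ℂ) • fnL P Ω u := rfl

theorem coeFn_shiftL (t : ℝ) (u : H0 P Ω) :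
    shiftL P Ω t u =ᵐ[volume] fun x => opL P Ω u x - t * fnL P Ω u x := by
  rw [shiftL_apply]
  filter_upwards [Lp.coeFn_sub (opL P Ω u) ((t : ℂ) • fnL P Ω u),
    Lp.coeFn_smul (t : ℂ) (fnL P Ω u)] with x h1 h2
  rw [h1, Pi.sub_apply, h2, Pi.smul_apply, smul_eq_mul]

theorem shiftL_ae_eq_zero (hΩ : MeasurableSet Ω) (t : ℝ) (u : H0 P Ω) :
    shiftL P Ω t u =ᵐ[volume.restrict Ωᶜ] 0 := by
  filter_upwards [ae_restrict_of_ae (coeFn_shiftL t u), fnL_ae_eq_zero hΩ u, opL_ae_eq_zero hΩ u]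
    with x h1 h2 h3
  rw [h1, h2, h3]; simp

/-- The operator of the form `∫ m |(P(D) - t) u|² - t ∫ (P(D) - t) u ū`; for `m = 1 / V` its kernel
describes the transmission eigenvalues. -/
def transOp (P : MvPolynomial (Fin n) ℝ) (Ω : Set (Rn n)) (m : Rn n → ℝ)
    (hm : MemLp (fun x => (m x : ℂ)) ∞ volume) (t : ℝ) : H0 P Ω →L[ℂ] H0 P Ω :=
  (shiftL P Ω t).adjoint ∘L (mulL _ hm ∘L shiftL P Ω t)
    - (fnL P Ω).adjoint ∘L ((t : ℂ) • shiftL P Ω t)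

variable {m : Rn n → ℝ} {hm : MemLp (fun x => (m x : ℂ)) ∞ volume}

theorem transOp_apply (t : ℝ) (u : H0 P Ω) :
    transOp P Ω m hm t u = (shiftL P Ω t).adjoint (mulL _ hm (shiftL P Ω t u))
      - (fnL P Ω).adjoint ((t : ℂ) • shiftL P Ω t u) := rfl

theorem inner_transOp (t : ℝ) (u v : H0 P Ω) :
    inner ℂ (transOp P Ω m hm t u) v = inner ℂ (mulL _ hm (shiftL P Ω t u)) (shiftL P Ω t v)
      - t * inner ℂ (shiftL P Ω t u) (fnL P Ω v) := by
  rw [transOp_apply, inner_sub_left, ContinuousLinearMap.adjoint_inner_left,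
    ContinuousLinearMap.adjoint_inner_left, inner_smul_left, Complex.conj_ofReal]

theorem isSelfAdjoint_transOp (t : ℝ) : IsSelfAdjoint (transOp P Ω m hm t) := by
  rw [ContinuousLinearMap.isSelfAdjoint_iff_isSymmetric]
  intro u v
  change inner ℂ (transOp P Ω m hm t u) v = inner ℂ u (transOp P Ω m hm t v)
  rw [← inner_conj_symm u, inner_transOp, inner_transOp, inner_mulL_symm, map_sub, map_mul,
    inner_conj_symm, inner_conj_symm, Complex.conj_ofReal]
  congr 2
  simp only [shiftL_apply, inner_sub_left, inner_sub_right, inner_smul_left, inner_smul_right,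
    Complex.conj_ofReal, inner_opL]

theorem continuous_transOp : Continuous (transOp P Ω m hm) := by
  have h : Continuous (shiftL P Ω) := by
    unfold shiftL
    exact continuous_const.sub (Complex.continuous_ofReal.smul continuous_const)
  have h' : Continuous fun t => (shiftL P Ω t).adjoint :=
    (ContinuousLinearMap.adjoint (𝕜 := ℂ) (E := H0 P Ω) (F := E2 n)).continuous.comp h
  unfold transOp
  exact (h'.clm_comp (continuous_const.clm_comp h)).sub
    (continuous_const.clm_comp (Complex.continuous_ofReal.smul h))

/-- Here `a = ‖u‖`, `b = ‖P(D) u‖`, `r = Re ⟨P(D) u, u⟩` and `s` is the finite rank term. The cross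
terms are split by Young's inequality, spending `κ/2` and `κ/4` of the coefficient of `b²`; the
constant `C` pays for the resulting multiples of `a²`. -/
theorem garding_algebra {κ t a b r s C Q : ℝ} (hκ : 0 < κ)
    (hC : C = κ / 4 + t ^ 2 * (κ + 1 / κ)) (hr : |r| ≤ b * a)
    (hQ : κ * (b ^ 2 - 2 * (t * r) + t ^ 2 * a ^ 2) ≤ Q)
    (hs : C * a ^ 2 ≤ κ / 8 * b ^ 2 + C * s) :
    κ / 8 * (a ^ 2 + b ^ 2) ≤ Q - (t * r - t ^ 2 * a ^ 2) + C * s := by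
  have h7 : |t * r| ≤ |t| * (b * a) := by rw [abs_mul]; gcongr
  have h9 : 2 * κ * (|t| * (b * a)) ≤ κ / 2 * b ^ 2 + 2 * κ * t ^ 2 * a ^ 2 := by
    have e : κ / 2 * b ^ 2 + 2 * κ * t ^ 2 * a ^ 2 - 2 * κ * (|t| * (b * a))
        = κ / 2 * (b - 2 * |t| * a) ^ 2 := by
      rw [← sq_abs t]; ring
    have : 0 ≤ κ / 2 * (b - 2 * |t| * a) ^ 2 := by positivity
    linarith
  have h10 : |t| * (b * a) ≤ κ / 4 * b ^ 2 + t ^ 2 * (1 / κ) * a ^ 2 := by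
    have e : κ / 4 * b ^ 2 + t ^ 2 * (1 / κ) * a ^ 2 - |t| * (b * a)
        = κ * (b / 2 - |t| * a / κ) ^ 2 := by
      rw [← sq_abs t]
      field_simp
      ring
    have : 0 ≤ κ * (b / 2 - |t| * a / κ) ^ 2 := by positivity
    linarith
  have h11 := (abs_le.1 h7).2
  have h12 : κ * (t * r) ≤ κ * (|t| * (b * a)) := mul_le_mul_of_nonneg_left h11 hκ.le
  have h13 : 0 ≤ t ^ 2 * a ^ 2 := by positivity
  have h14 : 0 ≤ κ * a ^ 2 := by positivity
  have h15 : C * a ^ 2 = κ * a ^ 2 / 4 + κ * (t ^ 2 * a ^ 2) + t ^ 2 * (1 / κ) * a ^ 2 := by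
    rw [hC]; ring
  linarith

theorem finiteRankGarding_transOp (hP : Tendsto (weight P) (cocompact (Rn n)) atTop)
    (hΩ : MeasurableSet Ω) (hb : Bornology.IsBounded Ω) {κ : ℝ} (hκ : 0 < κ)
    (hmκ : ∀ᵐ x ∂volume.restrict Ω, κ ≤ m x) (t : ℝ) :
    FiniteRankGarding (transOp P Ω m hm t) := by
  set C : ℝ := κ / 4 + t ^ 2 * (κ + 1 / κ) with hC
  have hCpos : 0 < C := by positivity
  -- After multiplication by `C` the compactness estimate costs only `κ / 8 * ‖P(D) u‖²`.
  obtain ⟨M, g, hg⟩ := exists_finite_rank_le_H0 hP hΩ hb (η := κ / (8 * C)) (by positivity)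
  refine ⟨κ / 8, by positivity, M,
    fun i => (fnL P Ω).adjoint (((Real.sqrt C : ℝ) : ℂ) • g i), fun u => ?_⟩
  have h4 : ∀ i, ‖inner ℂ ((fnL P Ω).adjoint (((Real.sqrt C : ℝ) : ℂ) • g i)) u‖ ^ 2
      = C * ‖inner ℂ (g i) (fnL P Ω u)‖ ^ 2 := by
    intro i
    rw [ContinuousLinearMap.adjoint_inner_left, inner_smul_left, Complex.conj_ofReal, norm_mul,
      Complex.norm_real, mul_pow, Real.norm_of_nonneg (Real.sqrt_nonneg _), Real.sq_sqrt hCpos.le]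
  simp only [h4]
  rw [← Finset.mul_sum]
  have h1 := hg u
  have h2 := le_re_inner_mulL hm hmκ (shiftL_ae_eq_zero hΩ t u)
  rw [inner_transOp, map_sub]
  have h3 : RCLike.re ((t : ℂ) * inner ℂ (shiftL P Ω t u) (fnL P Ω u))
      = t * RCLike.re (inner ℂ (opL P Ω u) (fnL P Ω u)) - t ^ 2 * ‖fnL P Ω u‖ ^ 2 := by
    rw [shiftL_apply, inner_sub_left, inner_smul_left, Complex.conj_ofReal,
      inner_self_eq_norm_sq_to_K]
    change ((t : ℂ) * (_ - (t : ℂ) * ((‖fnL P Ω u‖ : ℝ) : ℂ) ^ 2)).re = _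
    rw [← Complex.ofReal_pow, ← Complex.ofReal_mul, Complex.re_ofReal_mul, Complex.sub_re,
      Complex.ofReal_re]
    change _ = t * (inner ℂ (opL P Ω u) (fnL P Ω u)).re - _
    ring
  have h5 : ‖shiftL P Ω t u‖ ^ 2 = ‖opL P Ω u‖ ^ 2
      - 2 * (t * RCLike.re (inner ℂ (opL P Ω u) (fnL P Ω u))) + t ^ 2 * ‖fnL P Ω u‖ ^ 2 := by
    rw [shiftL_apply, norm_sub_sq (𝕜 := ℂ), inner_smul_right, norm_smul, Complex.norm_real, mul_pow,
      Real.norm_eq_abs, sq_abs]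
    congr 3
    exact Complex.re_ofReal_mul _ _
  have h6 : |RCLike.re (inner ℂ (opL P Ω u) (fnL P Ω u))| ≤ ‖opL P Ω u‖ * ‖fnL P Ω u‖ :=
    (RCLike.abs_re_le_norm _).trans (norm_inner_le_norm _ _)
  rw [h3, H0_norm_sq]
  rw [h5] at h2
  have h8 : C * ‖fnL P Ω u‖ ^ 2 ≤ κ / 8 * ‖opL P Ω u‖ ^ 2
      + C * ∑ i, ‖inner ℂ (g i) (fnL P Ω u)‖ ^ 2 := by
    calc C * ‖fnL P Ω u‖ ^ 2 ≤ C * (κ / (8 * C) * ‖opL P Ω u‖ ^ 2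
          + ∑ i, ‖inner ℂ (g i) (fnL P Ω u)‖ ^ 2) := by gcongr
      _ = _ := by field_simp
  exact garding_algebra hκ hC h6 h2 h8

theorem integral_mul_CS (g : E2 n) (f : CS n) :
    ∫ x, g x * f.1 x = inner ℂ (toL2 n (cconj f)) g := by
  rw [L2.inner_def]
  refine integral_congr_ae ?_
  filter_upwards [coeFn_toL2 (cconj f)] with x h
  rw [h]
  simp

/-- The transpose `P(-D)` on smooth compactly supported functions. -/
def transp (P : MvPolynomial (Fin n) ℝ) (f : CS n) : CS n := cconj (rho n (cx P) (cconj f))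

theorem transp_coe (P : MvPolynomial (Fin n) ℝ) (f : CS n) : (transp P f).1 = transposeOp P f.1 :=
  (transposeOp_eq_conj P f).symm

theorem cconj_cconj (f : CS n) : cconj (cconj f) = f := by
  ext x; simp

theorem integral_mul_transp (g : E2 n) (f : CS n) :
    ∫ x, g x * (transp P f).1 x = inner ℂ (toL2 n (rho n (cx P) (cconj f))) g := by
  rw [integral_mul_CS, transp, cconj_cconj]

theorem tsupport_cconj (f : CS n) : tsupport (cconj f).1 ⊆ tsupport f.1 :=
  closure_mono fun x hx h => hx (by simp [h])

theorem tsupport_transp (f : CS n) : tsupport (transp P f).1 ⊆ tsupport f.1 :=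
  (tsupport_cconj _).trans ((tsupport_rho_subset _ _).trans (tsupport_cconj f))

theorem integrable_mul_E2 (g : E2 n) (f : CS n) : Integrable fun x => g x * f.1 x := by
  have := (L2.integrable_inner (𝕜 := ℂ) (toL2 n (cconj f)) g)
  refine this.congr ?_
  filter_upwards [coeFn_toL2 (cconj f)] with x h
  rw [h]
  simp

theorem CS_eq_zero {f : CS n} (hf : tsupport f.1 ⊆ Ω) {x : Rn n} (hx : x ∉ Ω) : f.1 x = 0 := by
  by_contra h
  exact hx (hf (subset_tsupport _ h))

/-- A test function as a smooth compactly supported function. -/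
def ofTest {O : TopologicalSpace.Opens (Rn n)} (φ : 𝓓(O, ℂ)) : CS n :=
  ⟨φ, φ.contDiff, φ.hasCompactSupport⟩

theorem tsupport_ofTest {O : TopologicalSpace.Opens (Rn n)} (φ : 𝓓(O, ℂ)) :
    tsupport (ofTest φ).1 ⊆ O := φ.tsupport_subset

/-- A smooth function with compact support in `O` as a test function. -/
def toTest {O : TopologicalSpace.Opens (Rn n)} (f : CS n) (hf : tsupport f.1 ⊆ O) : 𝓓(O, ℂ) :=
  ⟨f.1, contDiff_CS f, hasCompactSupport_CS f, hf⟩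

/-- With `exists_H0_of_memH0`, this identifies the graph closure with the completion described by
Cauchy sequences of test functions. -/
theorem memH0_of_H0 {O : TopologicalSpace.Opens (Rn n)} (u : H0 P (O : Set (Rn n))) :
    MemH0 P O (fnL P O u) := by
  refine ⟨(Lp.memLp _).restrict _, ?_⟩
  obtain ⟨w, hw, hlim⟩ := mem_closure_iff_seq_limit.1 u.2
  choose f hf hfw using hw
  have hl1 : Tendsto (fun k => toL2 n (f k)) atTop (𝓝 (fnL P O u)) := by
    have := ((WithLp.fstL 2 ℂ (E2 n) (E2 n)).continuous.tendsto _).comp hlim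
    refine this.congr fun k => ?_
    simp only [Function.comp_apply, ← hfw]; rfl
  have hl2 : Tendsto (fun k => toL2 n (rho n (cx P) (f k))) atTop (𝓝 (opL P O u)) := by
    have := ((WithLp.sndL 2 ℂ (E2 n) (E2 n)).continuous.tendsto _).comp hlim
    refine this.congr fun k => ?_
    simp only [Function.comp_apply, ← hfw]; rfl
  refine ⟨fun k => toTest (f k) (hf k), ?_, ?_⟩
  · have h1 : Tendsto (fun k => ‖toL2 n (f k) - fnL P O u‖ₑ) atTop (𝓝 0) := by
      have := (tendsto_sub_nhds_zero_iff.2 hl1).enorm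
      simpa using this
    refine tendsto_of_tendsto_of_tendsto_of_le_of_le tendsto_const_nhds h1 (fun _ => zero_le)
      fun k => ?_
    rw [Lp.enorm_def]
    refine (eLpNorm_mono_measure _ Measure.restrict_le_self).trans (le_of_eq ?_)
    refine eLpNorm_congr_ae ?_
    filter_upwards [Lp.coeFn_sub (toL2 n (f k)) (fnL P O u), coeFn_toL2 (f k)] with x h2 h3
    rw [h2, Pi.sub_apply, h3]; rfl
  · have h1 : Tendsto (fun p : ℕ × ℕ => ‖toL2 n (rho n (cx P) (f p.1))
        - toL2 n (rho n (cx P) (f p.2))‖ₑ) atTop (𝓝 0) := by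
      rw [← prod_atTop_atTop_eq]
      have := ((hl2.comp (tendsto_fst (f := (atTop : Filter ℕ)) (g := (atTop : Filter ℕ)))).sub
        (hl2.comp (tendsto_snd (f := (atTop : Filter ℕ)) (g := (atTop : Filter ℕ))))).enorm
      simpa using this
    refine h1.congr fun p => ?_
    rw [← map_sub, ← map_sub, Lp.enorm_def]
    refine eLpNorm_congr_ae ((coeFn_toL2 _).trans ?_)
    rw [← diffOp_eq_rho]
    rfl

end AcousticITP
end

/-! ### From kernel vectors of `transOp` to transmission eigenvalues. -/

noncomputable section

namespace AcousticITP

open Complex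

variable {n : ℕ} {P : MvPolynomial (Fin n) ℝ}

theorem inner_testH0_opL {Ω : Set (Rn n)} (f : CS n) (hf : tsupport f.1 ⊆ Ω) (u : H0 P Ω) :
    inner ℂ (toL2 n (rho n (cx P) f)) (fnL P Ω u) = inner ℂ (toL2 n f) (opL P Ω u) := by
  have := inner_opL (testH0 P f hf) u
  rwa [fnL_testH0, opL_testH0] at this

theorem integral_fnL_mul_transp {Ω : Set (Rn n)} (f : CS n) (hf : tsupport f.1 ⊆ Ω) (u : H0 P Ω) :
    ∫ x, fnL P Ω u x * (transp P f).1 x = ∫ x, opL P Ω u x * f.1 x := by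
  rw [integral_mul_transp, integral_mul_CS, inner_testH0_opL _ ((tsupport_cconj f).trans hf)]

/-- The equation satisfied by `g = (1 / V) (P(D) - t) u` for `u` in the kernel of `transOp`. -/
theorem integral_mul_transp_of_transOp_eq_zero {Ω : Set (Rn n)} {m : Rn n → ℝ}
    {hm : MemLp (fun x => (m x : ℂ)) ∞ volume} {t : ℝ} {u : H0 P Ω}
    (hu : transOp P Ω m hm t u = 0) (f : CS n) (hf : tsupport f.1 ⊆ Ω) :
    ∫ x, mulL _ hm (shiftL P Ω t u) x * (transp P f).1 x
      = t * (∫ x, mulL _ hm (shiftL P Ω t u) x * f.1 x) + t * ∫ x, shiftL P Ω t u x * f.1 x := by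
  have h := inner_transOp (m := m) (hm := hm) t u (testH0 P (cconj f) ((tsupport_cconj f).trans hf))
  rw [hu, inner_zero_left, shiftL_apply t (testH0 _ _ _), fnL_testH0, opL_testH0, inner_sub_right,
    inner_smul_right] at h
  have h' := congrArg (starRingEnd ℂ) h
  simp only [map_zero, map_sub, map_mul, inner_conj_symm, Complex.conj_ofReal] at h'
  rw [integral_mul_transp, integral_mul_CS, integral_mul_CS]
  linear_combination -h'

theorem integral_fnL_mul_transp' {Ω : Set (Rn n)} (f : CS n) (hf : tsupport f.1 ⊆ Ω) (u : H0 P Ω)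
    (t : ℝ) : ∫ x, fnL P Ω u x * (transp P f).1 x
      = t * (∫ x, fnL P Ω u x * f.1 x) + ∫ x, shiftL P Ω t u x * f.1 x := by
  have i2 := (integrable_mul_E2 (fnL P Ω u) f).const_mul (t : ℂ)
  have h5 : ∫ x, shiftL P Ω t u x * f.1 x
      = (∫ x, opL P Ω u x * f.1 x) - t * ∫ x, fnL P Ω u x * f.1 x := by
    rw [← integral_const_mul, ← integral_sub (integrable_mul_E2 _ f) i2]
    refine integral_congr_ae ?_
    filter_upwards [coeFn_shiftL t u] with x hx
    rw [hx]; ring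
  rw [integral_fnL_mul_transp f hf, h5]
  ring

theorem setIntegral_eq_integral_CS {Ω : Set (Rn n)} {F : Rn n → ℂ} (hF : ∀ x ∉ Ω, F x = 0) :
    ∫ x in Ω, F x = ∫ x, F x :=
  setIntegral_eq_integral_of_forall_compl_eq_zero hF

theorem solvesIn_add {O : TopologicalSpace.Opens (Rn n)} {a g s : E2 n} {t : ℝ} (ht : t ≠ 0)
    (ha : ∀ f : CS n, tsupport f.1 ⊆ (O : Set (Rn n)) → ∫ x, a x * (transp P f).1 x
      = t * (∫ x, a x * f.1 x) + ∫ x, s x * f.1 x)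
    (hg : ∀ f : CS n, tsupport f.1 ⊆ (O : Set (Rn n)) → ∫ x, g x * (transp P f).1 x
      = t * (∫ x, g x * f.1 x) + t * ∫ x, s x * f.1 x) :
    SolvesIn P O (fun _ => (t : ℂ)) fun x => a x + -(t : ℂ)⁻¹ * g x := by
  intro φ
  have htc : (t : ℂ) ≠ 0 := by exact_mod_cast ht
  have hf : tsupport (ofTest φ).1 ⊆ (O : Set (Rn n)) := tsupport_ofTest φ
  change ∫ x in (O : Set (Rn n)), (a x + -(t : ℂ)⁻¹ * g x)
    * (transposeOp P (ofTest φ).1 x - t * (ofTest φ).1 x) = 0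
  generalize ofTest φ = f at *
  have hf0 : ∀ x ∉ (O : Set (Rn n)), f.1 x = 0 := fun x hx => CS_eq_zero hf hx
  have htf0 : ∀ x ∉ (O : Set (Rn n)), (transp P f).1 x = 0 := fun x hx =>
    CS_eq_zero ((tsupport_transp f).trans hf) hx
  rw [← transp_coe, setIntegral_eq_integral_CS fun x hx => by rw [hf0 x hx, htf0 x hx]; ring]
  have e : ∀ x, (a x + -(t : ℂ)⁻¹ * g x) * ((transp P f).1 x - t * f.1 x)
      = (a x * (transp P f).1 x - t * (a x * f.1 x))
        - (t : ℂ)⁻¹ * (g x * (transp P f).1 x - t * (g x * f.1 x)) := fun x => by ring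
  simp only [e]
  have i1 := integrable_mul_E2 a (transp P f)
  have i2 := (integrable_mul_E2 a f).const_mul (t : ℂ)
  have i3 := integrable_mul_E2 g (transp P f)
  have i4 := (integrable_mul_E2 g f).const_mul (t : ℂ)
  have i12 : Integrable fun x => a x * (transp P f).1 x - t * (a x * f.1 x) := i1.sub i2
  have i34 : Integrable fun x => g x * (transp P f).1 x - t * (g x * f.1 x) := i3.sub i4
  rw [integral_sub i12 (i34.const_mul _), integral_const_mul,
    integral_sub i1 i2, integral_sub i3 i4, integral_const_mul, integral_const_mul, ha f hf, hg f hf]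
  field_simp
  ring

theorem solvesIn_mul {O : TopologicalSpace.Opens (Rn n)} {g s : E2 n} {V : Rn n → ℝ} {t : ℝ}
    (hVg : ∀ᵐ x ∂volume.restrict (O : Set (Rn n)), (V x : ℂ) * g x = s x)
    (hg : ∀ f : CS n, tsupport f.1 ⊆ (O : Set (Rn n)) → ∫ x, g x * (transp P f).1 x
      = t * (∫ x, g x * f.1 x) + t * ∫ x, s x * f.1 x) :
    SolvesIn P O (fun x => (t : ℂ) * (1 + (V x : ℂ))) fun x => -(t : ℂ)⁻¹ * g x := by
  intro φ
  have hf : tsupport (ofTest φ).1 ⊆ (O : Set (Rn n)) := tsupport_ofTest φ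
  change ∫ x in (O : Set (Rn n)), (-(t : ℂ)⁻¹ * g x)
    * (transposeOp P (ofTest φ).1 x - t * (1 + V x) * (ofTest φ).1 x) = 0
  generalize ofTest φ = f at *
  have hf0 : ∀ x ∉ (O : Set (Rn n)), f.1 x = 0 := fun x hx => CS_eq_zero hf hx
  have htf0 : ∀ x ∉ (O : Set (Rn n)), (transp P f).1 x = 0 := fun x hx =>
    CS_eq_zero ((tsupport_transp f).trans hf) hx
  rw [← transp_coe]
  have e : ∫ x in (O : Set (Rn n)), (-(t : ℂ)⁻¹ * g x)
      * ((transp P f).1 x - t * (1 + V x) * f.1 x)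
      = ∫ x in (O : Set (Rn n)), -(t : ℂ)⁻¹ * (g x * (transp P f).1 x - t * (g x * f.1 x)
        - t * (s x * f.1 x)) := by
    refine integral_congr_ae ?_
    filter_upwards [hVg] with x hx
    rw [← hx]; ring
  rw [e, setIntegral_eq_integral_CS fun x hx => by rw [hf0 x hx, htf0 x hx]; ring]
  have i3 := integrable_mul_E2 g (transp P f)
  have i4 := (integrable_mul_E2 g f).const_mul (t : ℂ)
  have i5 := (integrable_mul_E2 s f).const_mul (t : ℂ)
  have i34 : Integrable fun x => g x * (transp P f).1 x - t * (g x * f.1 x) := i3.sub i4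
  rw [integral_const_mul, integral_sub i34 i5, integral_sub i3 i4, integral_const_mul,
    integral_const_mul, hg f hf]
  ring

/-- The data are `a = u`, `b = P(D) u`, `s = (P - t) u`, `g = s / V`, and the solutions are `w = -g
/ t`, `v = u + w`. If `v = 0` then `P(D) u = t (1 + V) u`, and if `w = 0` then `P(D) u = t u`;
either contradicts `hne`. -/
theorem isTransmissionEigenvalue_of_equations {O : TopologicalSpace.Opens (Rn n)}
    {a b g s : E2 n} {V : Rn n → ℝ} {K t : ℝ} (ht : t ≠ 0)
    (hV : ∀ᵐ x ∂volume.restrict (O : Set (Rn n)), |V x| ≤ K)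
    (hne : ∀ C : ℝ, ¬ ∀ᵐ x ∂volume.restrict (O : Set (Rn n)), ‖b x‖ ≤ C * ‖a x‖)
    (hs : ∀ᵐ x ∂volume.restrict (O : Set (Rn n)), s x = b x - t * a x)
    (hVg : ∀ᵐ x ∂volume.restrict (O : Set (Rn n)), (V x : ℂ) * g x = s x)
    (ha : ∀ f : CS n, tsupport f.1 ⊆ (O : Set (Rn n)) → ∫ x, a x * (transp P f).1 x
      = t * (∫ x, a x * f.1 x) + ∫ x, s x * f.1 x)
    (hg : ∀ f : CS n, tsupport f.1 ⊆ (O : Set (Rn n)) → ∫ x, g x * (transp P f).1 x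
      = t * (∫ x, g x * f.1 x) + t * ∫ x, s x * f.1 x)
    (hmem : MemH0 P O a) :
    IsTransmissionEigenvalue P O V (t : ℂ) := by
  have htc : (t : ℂ) ≠ 0 := by exact_mod_cast ht
  have hop : ∀ᵐ x ∂volume.restrict (O : Set (Rn n)), b x = t * a x + V x * g x := by
    filter_upwards [hVg, hs] with x h1 h2
    rw [h1, h2]; ring
  have hw2 : MemLp (fun x => -(t : ℂ)⁻¹ * g x) 2 volume := (Lp.memLp g).const_mul _
  have hv2 : MemLp (fun x => a x + -(t : ℂ)⁻¹ * g x) 2 volume := (Lp.memLp a).add hw2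
  refine ⟨fun x => a x + -(t : ℂ)⁻¹ * g x, fun x => -(t : ℂ)⁻¹ * g x,
    fun L _ _ => hv2.restrict L, fun L _ _ => hw2.restrict L, ?_, ?_,
    solvesIn_add ht ha hg, solvesIn_mul hVg hg, ?_⟩
  · intro hv
    refine hne (|t| * (1 + K)) ?_
    filter_upwards [hv, hop, hV] with x h1 h2 h3
    have h4 : g x = t * a x := by
      simp only [Pi.zero_apply] at h1
      field_simp at h1
      linear_combination -h1
    rw [h2, h4, show (t : ℂ) * a x + V x * (t * a x)
      = t * (1 + V x) * a x by ring, norm_mul, norm_mul, Complex.norm_real,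
      Real.norm_eq_abs]
    gcongr
    refine (norm_add_le _ _).trans ?_
    rw [norm_one, Complex.norm_real, Real.norm_eq_abs]
    gcongr
  · intro hw
    refine hne |t| ?_
    filter_upwards [hw, hop] with x h1 h2
    have h4 : g x = 0 := by
      simp only [Pi.zero_apply] at h1
      simpa [htc] using h1
    rw [h2, h4, mul_zero, add_zero, norm_mul, Complex.norm_real, Real.norm_eq_abs]
  · have e : (fun x => a x + -(t : ℂ)⁻¹ * g x - -(t : ℂ)⁻¹ * g x) = a := by
      ext x; ring
    rw [e]
    exact hmem

theorem isTransmissionEigenvalue_of_transOp_eq_zero {O : TopologicalSpace.Opens (Rn n)}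
    (hdeg : P.totalDegree ≠ 0)
    (hb : Bornology.IsBounded (O : Set (Rn n))) {V m : Rn n → ℝ} {K : ℝ}
    (hV : ∀ᵐ x ∂volume.restrict (O : Set (Rn n)), |V x| ≤ K)
    {hm : MemLp (fun x => (m x : ℂ)) ∞ volume}
    (hVm : ∀ᵐ x ∂volume.restrict (O : Set (Rn n)), V x * m x = 1) {t : ℝ} (ht : t ≠ 0)
    {u : H0 P (O : Set (Rn n))} (hu : transOp P O m hm t u = 0) (hu0 : u ≠ 0) :
    IsTransmissionEigenvalue P O V (t : ℂ) := by
  refine isTransmissionEigenvalue_of_equations (a := fnL P O u) (b := opL P O u)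
    (g := mulL _ hm (shiftL P O t u)) (s := shiftL P O t u) ht hV
    (fun C h => hu0 (eq_zero_of_norm_opL_le hdeg O.isOpen.measurableSet hb u C h))
    (ae_restrict_of_ae (coeFn_shiftL t u)) ?_
    (fun f hf => integral_fnL_mul_transp' f hf u t)
    (fun f hf => integral_mul_transp_of_transOp_eq_zero hu f hf) (memH0_of_H0 u)
  filter_upwards [hVm, ae_restrict_of_ae (coeFn_mulL _ hm (shiftL P O t u))] with x h1 h2
  rw [h2, ← mul_assoc, ← Complex.ofReal_mul, h1, Complex.ofReal_one, one_mul]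

theorem exists_H0_of_memH0 {O : TopologicalSpace.Opens (Rn n)} {w : Rn n → ℂ} (hw : MemH0 P O w) :
    ∃ u : H0 P (O : Set (Rn n)), fnL P O u =ᵐ[volume.restrict (O : Set (Rn n))] w := by
  have hΩ : MeasurableSet (O : Set (Rn n)) := O.isOpen.measurableSet
  obtain ⟨hmem, φ, hφ, hcau⟩ := hw
  have hind : MemLp ((O : Set (Rn n)).indicator w) 2 volume := (memLp_indicator_iff_restrict hΩ).2 hmem
  set f : ℕ → CS n := fun k => ofTest (φ k)
  have hf : ∀ k, tsupport (f k).1 ⊆ (O : Set (Rn n)) := fun k => tsupport_ofTest (φ k)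
  have hl1 : Tendsto (fun k => toL2 n (f k)) atTop (𝓝 hind.toLp) := by
    rw [tendsto_iff_edist_tendsto_0]
    refine hφ.congr fun k => ?_
    rw [edist_eq_enorm_sub, Lp.enorm_def, ← eLpNorm_indicator_eq_eLpNorm_restrict hΩ]
    refine eLpNorm_congr_ae ?_
    filter_upwards [Lp.coeFn_sub (toL2 n (f k)) hind.toLp, coeFn_toL2 (f k), hind.coeFn_toLp]
      with x h2 h3 h4
    rw [h2, Pi.sub_apply, h3, h4]
    by_cases hx : x ∈ (O : Set (Rn n))
    · rw [Set.indicator_of_mem hx, Set.indicator_of_mem hx]; rfl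
    · rw [Set.indicator_of_notMem hx, Set.indicator_of_notMem hx, CS_eq_zero (hf k) hx, sub_zero]
  have hcs : CauchySeq fun k => toL2 n (rho n (cx P) (f k)) := by
    rw [EMetric.cauchySeq_iff]
    intro ε hε
    have hev := hcau.eventually (gt_mem_nhds hε)
    obtain ⟨N, hN⟩ := eventually_atTop.1 hev
    refine ⟨max N.1 N.2, fun p hp q hq => ?_⟩
    have h1 := hN (p, q) ⟨(le_max_left _ _).trans hp, (le_max_right _ _).trans hq⟩
    refine lt_of_eq_of_lt ?_ h1
    rw [edist_eq_enorm_sub, ← map_sub, ← map_sub, Lp.enorm_def]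
    refine eLpNorm_congr_ae ((coeFn_toL2 _).trans ?_)
    rw [← diffOp_eq_rho]
    rfl
  obtain ⟨b, hb⟩ := cauchySeq_tendsto_of_complete hcs
  have hlim : Tendsto (fun k => graphMap P (f k)) atTop (𝓝 (WithLp.toLp 2 (hind.toLp, b))) :=
    ((WithLp.prod_continuous_toLp 2 (E2 n) (E2 n)).tendsto _).comp (hl1.prodMk_nhds hb)
  refine ⟨⟨_, mem_closure_of_tendsto hlim (Eventually.of_forall fun k => ⟨f k, hf k, rfl⟩)⟩, ?_⟩
  change hind.toLp =ᵐ[volume.restrict (O : Set (Rn n))] w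
  filter_upwards [ae_restrict_of_ae hind.coeFn_toLp, ae_restrict_mem hΩ] with x h1 hx
  rw [h1, Set.indicator_of_mem hx]

end AcousticITP
end

/-! ### From transmission eigenvalues of a constant potential to null vectors. -/

noncomputable section

namespace AcousticITP

open Complex

variable {n : ℕ} {P : MvPolynomial (Fin n) ℝ}

theorem MemL2Loc.integrable_mul {O : TopologicalSpace.Opens (Rn n)} {v : Rn n → ℂ}
    (hv : MemL2Loc O v) (f : CS n) (hf : tsupport f.1 ⊆ (O : Set (Rn n))) :
    Integrable fun x => v x * f.1 x := by
  have hf2 : MemLp f.1 2 (volume.restrict (tsupport f.1)) :=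
    ((continuous_CS f).memLp_of_hasCompactSupport (hasCompactSupport_CS f)).restrict _
  have h1 : IntegrableOn (fun x => v x * f.1 x) (tsupport f.1) :=
    (hv _ (hasCompactSupport_CS f) hf).integrable_mul hf2
  refine (integrableOn_iff_integrable_of_support_subset fun x hx => ?_).1 h1
  exact subset_tsupport _ (right_ne_zero_of_mul hx)

theorem MemL2Loc.locallyIntegrableOn {O : TopologicalSpace.Opens (Rn n)} {v : Rn n → ℂ}
    (hv : MemL2Loc O v) : LocallyIntegrableOn v (O : Set (Rn n)) := by
  rw [locallyIntegrableOn_iff O.isOpen.isLocallyClosed]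
  intro k hk hkc
  have : IsFiniteMeasure ((volume : Measure (Rn n)).restrict k) :=
    ⟨by simpa using hkc.measure_lt_top⟩
  exact (hv k hkc hk).integrable one_le_two

theorem SolvesIn.integral_eq_zero {O : TopologicalSpace.Opens (Rn n)} {q : Rn n → ℂ}
    {v : Rn n → ℂ} (hv : SolvesIn P O q v) (f : CS n) (hf : tsupport f.1 ⊆ (O : Set (Rn n))) :
    ∫ x in (O : Set (Rn n)), v x * ((transp P f).1 x - q x * f.1 x) = 0 := by
  have := hv (toTest f hf)
  rw [transp_coe]
  exact this

/-- Subtracting the two equations gives `(P - t)(v - w) = -t δ w` as distributions, hence almost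
everywhere. For `t δ ≠ 0` it shows that `w`, assumed only locally square integrable, lies in
`L²(Ω)`. -/
theorem transmission_ae_eq {O : TopologicalSpace.Opens (Rn n)} {a s : E2 n} {v w : Rn n → ℂ}
    {t δ : ℝ} (hv : MemL2Loc O v) (hw : MemL2Loc O w)
    (hvs : SolvesIn P O (fun _ => (t : ℂ)) v)
    (hws : SolvesIn P O (fun _ => (t : ℂ) * (1 + (δ : ℂ))) w)
    (ha : ∀ f : CS n, tsupport f.1 ⊆ (O : Set (Rn n)) → ∫ x, a x * (transp P f).1 x
      = t * (∫ x, a x * f.1 x) + ∫ x, s x * f.1 x)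
    (hvw : ∀ᵐ x ∂volume.restrict (O : Set (Rn n)), a x = v x - w x) :
    ∀ᵐ x ∂volume.restrict (O : Set (Rn n)), s x + t * δ * w x = 0 := by
  have hs : MemL2Loc O s := fun _ _ _ => (Lp.memLp s).restrict _
  have hloc : LocallyIntegrableOn (fun x => s x + t * δ * w x) (O : Set (Rn n)) :=
    hs.locallyIntegrableOn.add (hw.locallyIntegrableOn.smul (t * δ : ℂ))
  have key : ∀ f : CS n, tsupport f.1 ⊆ (O : Set (Rn n)) →
      ∫ x, (s x + t * δ * w x) * f.1 x = 0 := by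
    intro f hf
    have hf0 : ∀ x ∉ (O : Set (Rn n)), f.1 x = 0 := fun x hx => CS_eq_zero hf hx
    have htf := (tsupport_transp (P := P) f).trans hf
    have htf0 : ∀ x ∉ (O : Set (Rn n)), (transp P f).1 x = 0 := fun x hx => CS_eq_zero htf hx
    have ev := hvs.integral_eq_zero f hf
    have ew := hws.integral_eq_zero f hf
    rw [setIntegral_eq_integral_CS fun x hx => by rw [hf0 x hx, htf0 x hx]; ring] at ev ew
    have iv1 := hv.integrable_mul _ htf
    have iv2 := (hv.integrable_mul f hf).const_mul (t : ℂ)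
    have iw1 := hw.integrable_mul _ htf
    have iw2 := (hw.integrable_mul f hf).const_mul (t : ℂ)
    have iw3 := (hw.integrable_mul f hf).const_mul (t * δ : ℂ)
    have ia1 := integrable_mul_E2 a (transp P f)
    have ia2 := (integrable_mul_E2 a f).const_mul (t : ℂ)
    have is := integrable_mul_E2 s f
    have e1 : ∫ x, s x * f.1 x = ∫ x, (a x * (transp P f).1 x - t * (a x * f.1 x)) := by
      rw [integral_sub ia1 ia2, integral_const_mul, ha f hf]; ring
    have e2 : ∫ x, (a x * (transp P f).1 x - t * (a x * f.1 x))
        = ∫ x, (v x * ((transp P f).1 x - t * f.1 x)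
          - (w x * ((transp P f).1 x - t * (1 + δ) * f.1 x) + t * δ * (w x * f.1 x))) := by
      refine integral_congr_ae
        (ae_of_ae_restrict_of_ae_restrict_compl (O : Set (Rn n)) ?_ ?_)
      · filter_upwards [hvw] with x hx
        rw [hx]; ring
      · filter_upwards [ae_restrict_mem O.isOpen.measurableSet.compl] with x hx
        rw [hf0 x hx, htf0 x hx]; ring
    have iv : Integrable fun x => v x * ((transp P f).1 x - t * f.1 x) :=
      (iv1.sub iv2).congr (ae_of_all _ fun x => by simp only [Pi.sub_apply]; ring)
    have iw : Integrable fun x => w x * ((transp P f).1 x - t * (1 + δ) * f.1 x) :=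
      ((iw1.sub iw2).sub iw3).congr (ae_of_all _ fun x => by simp only [Pi.sub_apply]; ring)
    have iw' : Integrable fun x =>
        w x * ((transp P f).1 x - t * (1 + δ) * f.1 x) + t * δ * (w x * f.1 x) := iw.add iw3
    rw [integral_sub iv iw', integral_add iw iw3, ev, ew] at e2
    simp only [add_mul, mul_assoc _ (w _)]
    rw [integral_add is iw3, e1, e2]
    ring
  have := O.isOpen.ae_eq_zero_of_integral_contDiff_smul_eq_zero hloc ?_
  · rw [ae_restrict_iff' O.isOpen.measurableSet]
    exact this
  · intro g hg hgc hgO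
    have hsupp : tsupport (fun x => ((g x : ℝ) : ℂ)) ⊆ tsupport g :=
      closure_mono fun x hx h => hx (by simp [h])
    have h := key ⟨fun x => ((g x : ℝ) : ℂ), Complex.ofRealCLM.contDiff.comp hg,
      hgc.comp_left Complex.ofReal_zero⟩ (hsupp.trans hgO)
    rw [← h]
    refine integral_congr_ae (ae_of_all _ fun x => ?_)
    simp only [Complex.real_smul]
    ring

/-- A transmission eigenvalue for a constant potential yields a nontrivial zero of the quadratic
form. -/
theorem exists_null_of_isTransmissionEigenvalue {O : TopologicalSpace.Opens (Rn n)} {δ t : ℝ}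
    (hδ : δ ≠ 0) (ht : t ≠ 0) (h : IsTransmissionEigenvalue P O (fun _ => δ) (t : ℂ)) :
    ∃ u : H0 P (O : Set (Rn n)), u ≠ 0 ∧
      ‖shiftL P O t u‖ ^ 2 = t * δ * RCLike.re (inner ℂ (shiftL P O t u) (fnL P O u)) := by
  obtain ⟨v, w, hv, hw, -, hw0, hvs, hws, hmem⟩ := h
  obtain ⟨u, hu⟩ := exists_H0_of_memH0 hmem
  have htd : (t * δ : ℂ) ≠ 0 := by exact_mod_cast mul_ne_zero ht hδ
  have hs := transmission_ae_eq hv hw hvs hws (fun f hf => integral_fnL_mul_transp' f hf u t) hu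
  refine ⟨u, ?_, ?_⟩
  · rintro rfl
    apply hw0
    have h0 := (Lp.coeFn_zero ℂ 2 (volume : Measure (Rn n)))
    rw [map_zero] at hs
    filter_upwards [hs, ae_restrict_of_ae h0] with x h1 h2
    rw [h2, Pi.zero_apply, zero_add] at h1
    exact (mul_eq_zero.1 h1).resolve_left htd
  -- `(P - t) u` is a multiple of `w` on the open set and belongs to `L²`, so the equation for `w`
  -- may be tested with all of `H^P_0`, in particular with `u` itself.
  · have key : ∀ u' : H0 P (O : Set (Rn n)), inner ℂ (opL P O u') (shiftL P O t u)
        = t * (1 + δ) * inner ℂ (fnL P O u') (shiftL P O t u) := by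
      intro u'
      obtain ⟨s, hs'⟩ : ∃ s, s = shiftL P O t u := ⟨_, rfl⟩
      rw [← hs'] at hs ⊢
      refine H0_induction' (p := fun a b => inner ℂ b s = t * (1 + δ) * inner ℂ a s)
        (isClosed_eq (by fun_prop) (by fun_prop)) (fun f hf => ?_) u'
      have hf' := (tsupport_cconj f).trans hf
      have hf0 : ∀ x ∉ (O : Set (Rn n)), (cconj f).1 x = 0 := fun x hx => CS_eq_zero hf' hx
      have htf0 : ∀ x ∉ (O : Set (Rn n)), (transp P (cconj f)).1 x = 0 := fun x hx =>
        CS_eq_zero ((tsupport_transp _).trans hf') hx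
      have e := hws.integral_eq_zero _ hf'
      have e2 : ∫ x in (O : Set (Rn n)), s x * (transp P (cconj f)).1 x
          - t * (1 + δ) * (s x * (cconj f).1 x)
          = -(t * δ) * ∫ x in (O : Set (Rn n)), w x * ((transp P (cconj f)).1 x
            - t * (1 + δ) * (cconj f).1 x) := by
        rw [← integral_const_mul]
        refine integral_congr_ae ?_
        filter_upwards [hs] with x hx
        linear_combination ((transp P (cconj f)).1 x - t * (1 + δ) * (cconj f).1 x) * hx
      rw [e, mul_zero, setIntegral_eq_integral_CS fun x hx => by rw [hf0 x hx, htf0 x hx]; ring,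
        integral_sub (integrable_mul_E2 _ _) ((integrable_mul_E2 _ _).const_mul _),
        integral_const_mul, integral_mul_transp, integral_mul_CS, cconj_cconj] at e2
      exact sub_eq_zero.1 e2
    have h1 := key u
    have h2 : inner ℂ (shiftL P O t u) (shiftL P O t u)
        = t * δ * inner ℂ (fnL P O u) (shiftL P O t u) := by
      conv_lhs => rw [shiftL_apply, inner_sub_left, ← shiftL_apply, inner_smul_left,
        Complex.conj_ofReal, h1]
      ring
    rw [← inner_self_eq_norm_sq (𝕜 := ℂ), h2, ← inner_conj_symm (shiftL P O t u),
      ← Complex.ofReal_mul, RCLike.conj_re]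
    exact Complex.re_ofReal_mul _ _

/-! ### Translated null vectors on disjoint balls. -/

/-- Translation of smooth compactly supported functions. -/
def transCS (a : Rn n) (f : CS n) : CS n :=
  ⟨fun x => f.1 (x - a), (contDiff_CS f).comp (contDiff_id.sub contDiff_const),
    (hasCompactSupport_CS f).comp_homeomorph (Homeomorph.subRight a)⟩

theorem Dl_transCS (a : Rn n) (j : Fin n) (f : CS n) : Dl j (transCS a f) = transCS a (Dl j f) := by
  ext x
  change -I * fderiv ℝ (fun x => f.1 (x - a)) x _ = -I * fderiv ℝ f.1 (x - a) _
  rw [fderiv_comp_sub]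

theorem rho_transCS (a : Rn n) (Q : MvPolynomial (Fin n) ℂ) (f : CS n) :
    rho n Q (transCS a f) = transCS a (rho n Q f) := by
  induction Q using MvPolynomial.induction_on generalizing f with
  | C c => rw [rho_C]; rfl
  | add p q hp hq =>
    rw [map_add, LinearMap.add_apply, LinearMap.add_apply, hp, hq]; rfl
  | mul_X p k hp => rw [rho_mul_apply, rho_mul_apply, rho_X, Dl_transCS, hp]

/-- Translation on `L²`. -/
def transL (a : Rn n) : E2 n →ₗᵢ[ℂ] E2 n :=
  Lp.compMeasurePreservingₗᵢ ℂ (fun x => x - a) (measurePreserving_sub_right volume a)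

theorem transL_toL2 (a : Rn n) (f : CS n) : transL a (toL2 n f) = toL2 n (transCS a f) :=
  Lp.toLp_compMeasurePreserving
    ((continuous_CS f).memLp_of_hasCompactSupport (hasCompactSupport_CS f))
    (measurePreserving_sub_right volume a)

theorem tsupport_transCS (a : Rn n) (f : CS n) :
    tsupport (transCS a f).1 ⊆ (fun x => x - a) ⁻¹' tsupport f.1 :=
  closure_minimal (fun _ hx => subset_tsupport f.1 hx)
    ((isClosed_tsupport f.1).preimage (continuous_id.sub continuous_const))

/-- Constant coefficient operators commute with translations, so translating test functions acts on
the graph and on its closure. -/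
theorem exists_translate {A B : Set (Rn n)} {a : Rn n} (h : ∀ x, x - a ∈ A → x ∈ B)
    (u : H0 P A) : ∃ u' : H0 P B, fnL P B u' = transL a (fnL P A u) ∧
      opL P B u' = transL a (opL P A u) := by
  have hcl : IsClosed {w : E2 n × E2 n | WithLp.toLp 2 (transL a w.1, transL a w.2) ∈ H0 P B} :=
    (Submodule.isClosed_topologicalClosure _).preimage
      ((WithLp.prod_continuous_toLp 2 (E2 n) (E2 n)).comp
        (((transL a).continuous.comp continuous_fst).prodMk
          ((transL a).continuous.comp continuous_snd)))
  have hmem := H0_induction' (P := P) (Ω := A)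
    (p := fun f g => WithLp.toLp 2 (transL a f, transL a g) ∈ H0 P B) hcl (fun f hf => ?_) u
  · exact ⟨⟨_, hmem⟩, rfl, rfl⟩
  · rw [transL_toL2, transL_toL2, ← rho_transCS]
    refine Submodule.le_topologicalClosure _ ⟨transCS a f, fun x hx => h x ?_, rfl⟩
    exact hf (tsupport_transCS a f hx)

theorem inner_eq_zero_of_disjoint {f g : E2 n} {A B : Set (Rn n)}
    (hf : f =ᵐ[volume.restrict Aᶜ] 0) (hg : g =ᵐ[volume.restrict Bᶜ] 0) (hA : MeasurableSet A)
    (hB : MeasurableSet B) (hAB : Disjoint A B) : inner ℂ f g = 0 := by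
  rw [L2.inner_def]
  refine integral_eq_zero_of_ae ?_
  filter_upwards [(ae_restrict_iff' hA.compl).1 hf, (ae_restrict_iff' hB.compl).1 hg] with x h1 h2
  by_cases hx : x ∈ A
  · rw [h2 (Set.disjoint_left.1 hAB hx)]; simp
  · rw [h1 hx]; simp

/-- With the off-diagonal terms gone, the form on a combination is the sum of the diagonal values
weighted by `|c_i|²`. -/
theorem nonposOn_span {H : Type*} [NormedAddCommGroup H] [InnerProductSpace ℂ H] {ι : Type*}
    [Fintype ι] (T : H →L[ℂ] H) (u : ι → H)
    (hoff : ∀ i j, i ≠ j → inner ℂ (T (u i)) (u j) = 0)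
    (hdiag : ∀ i, RCLike.re (inner ℂ (T (u i)) (u i)) ≤ 0) :
    NonposOn T (Submodule.span ℂ (Set.range u)) := by
  classical
  intro w hw
  obtain ⟨c, rfl⟩ := (Submodule.mem_span_range_iff_exists_fun ℂ).1 hw
  rw [map_sum, sum_inner, map_sum]
  refine Finset.sum_nonpos fun i _ => ?_
  rw [inner_sum, Finset.sum_eq_single i]
  · rw [map_smul, inner_smul_left, inner_smul_right, ← mul_assoc, mul_comm (starRingEnd ℂ _),
      Complex.mul_conj, RCLike.re_eq_complex_re, Complex.re_ofReal_mul]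
    exact mul_nonpos_of_nonneg_of_nonpos (Complex.normSq_nonneg _) (hdiag i)
  · intro j _ hj
    rw [map_smul, inner_smul_left, inner_smul_right, hoff i j hj.symm, mul_zero, mul_zero]
  · simp

/-- Pairwise disjoint small balls of equal radius in an open set. -/
theorem exists_disjoint_balls (hn : 0 < n) (O : TopologicalSpace.Opens (Rn n))
    (hO : (O : Set (Rn n)).Nonempty) (N : ℕ) : ∃ (ε : ℝ) (a : Fin N → Rn n), 0 < ε ∧
      (∀ i, Metric.ball (a i) ε ⊆ (O : Set (Rn n))) ∧
      ∀ i j, i ≠ j → Disjoint (Metric.ball (a i) ε) (Metric.ball (a j) ε) := by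
  obtain ⟨x₀, hx₀⟩ := hO
  obtain ⟨r, hr, hsub⟩ := Metric.isOpen_iff.1 O.isOpen x₀ hx₀
  set e : Rn n := EuclideanSpace.single ⟨0, hn⟩ 1
  have he : ‖e‖ = 1 := by simp [e]
  -- The centres are spaced by `d` along a coordinate axis and the radius is `d / 2`; the last ball
  -- reaches distance `(N - 1) d + d / 2 < r`.
  set d : ℝ := r / (N + 1) with hd
  have hdpos : 0 < d := by positivity
  have hdr : d * (N + 1) = r := by rw [hd]; field_simp
  refine ⟨d / 2, fun i => x₀ + ((i : ℕ) * d : ℝ) • e, by positivity, fun i => ?_, fun i j hij => ?_⟩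
  · refine (Metric.ball_subset_ball' ?_).trans hsub
    rw [dist_eq_norm, add_sub_cancel_left, norm_smul, he, mul_one,
      Real.norm_of_nonneg (by positivity)]
    have : ((i : ℕ) : ℝ) + 1 ≤ N := by exact_mod_cast i.2
    nlinarith
  · refine Metric.ball_disjoint_ball ?_
    rw [dist_eq_norm, add_sub_add_left_eq_sub, ← sub_smul, norm_smul, he, mul_one, ← sub_mul,
      norm_mul, Real.norm_of_nonneg hdpos.le, add_halves]
    refine le_mul_of_one_le_left hdpos.le ?_
    rw [Real.norm_eq_abs]
    have h1 : ((i : ℕ) : ℤ) - ((j : ℕ) : ℤ) ≠ 0 := by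
      rw [sub_ne_zero]
      exact_mod_cast fun h => hij (Fin.ext h)
    exact_mod_cast Int.one_le_abs h1

/-- The form of `transOp` is nonpositive on a subspace of prescribed dimension, at some parameter,
if each constant potential `δ` on small balls has a nonzero transmission eigenvalue. -/
theorem exists_nonposOn_transOp (hn : 0 < n) {O : TopologicalSpace.Opens (Rn n)}
    (hO : (O : Set (Rn n)).Nonempty) {δ : ℝ} (hδ : 0 < δ) {m : Rn n → ℝ}
    {hm : MemLp (fun x => (m x : ℂ)) ∞ volume}
    (hmδ : ∀ᵐ x ∂volume.restrict (O : Set (Rn n)), m x ≤ δ⁻¹)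
    (hball : ∀ ε : ℝ, 0 < ε → ∃ μ : ℝ, μ ≠ 0 ∧
      IsTransmissionEigenvalue P (ballO n ε) (fun _ => δ) (μ : ℂ)) (N : ℕ) :
    ∃ (t : ℝ) (W : Submodule ℂ (H0 P (O : Set (Rn n)))), Module.finrank ℂ W = N ∧
      NonposOn (transOp P O m hm t) W := by
  obtain ⟨ε, a, hε, hsub, hdisj⟩ := exists_disjoint_balls hn O hO N
  obtain ⟨t, ht, hev⟩ := hball ε hε
  obtain ⟨u, hu0, hu⟩ := exists_null_of_isTransmissionEigenvalue hδ.ne' ht hev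
  have hΩ : MeasurableSet (O : Set (Rn n)) := O.isOpen.measurableSet
  have hb : ∀ i x, x - a i ∈ (ballO n ε : Set (Rn n)) → x ∈ Metric.ball (a i) ε := by
    intro i x hx
    have hx' : x - a i ∈ Metric.ball (0 : Rn n) ε := hx
    rw [mem_ball_zero_iff] at hx'
    rwa [Metric.mem_ball, dist_eq_norm]
  -- Each translate is taken twice: `w i` on its own ball, to locate the support, and `z i` with the
  -- same underlying function in the space over the whole domain.
  choose w hw1 hw2 using fun i => exists_translate (P := P) (hb i) u
  choose z hz1 hz2 using fun i => exists_translate (P := P) (fun x hx => hsub i (hb i x hx)) u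
  have hfn : ∀ i, fnL P O (z i) =ᵐ[volume.restrict (Metric.ball (a i) ε)ᶜ] 0 := by
    intro i
    rw [hz1, ← hw1]
    exact fnL_ae_eq_zero measurableSet_ball (w i)
  have hop : ∀ i, opL P O (z i) =ᵐ[volume.restrict (Metric.ball (a i) ε)ᶜ] 0 := by
    intro i
    rw [hz2, ← hw2]
    exact opL_ae_eq_zero measurableSet_ball (w i)
  have hsh : ∀ i, shiftL P O t (z i) =ᵐ[volume.restrict (Metric.ball (a i) ε)ᶜ] 0 := by
    intro i
    filter_upwards [ae_restrict_of_ae (coeFn_shiftL t (z i)), hfn i, hop i] with x h1 h2 h3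
    rw [h1, h2, h3]; simp
  have hmsh : ∀ i, mulL _ hm (shiftL P O t (z i)) =ᵐ[volume.restrict (Metric.ball (a i) ε)ᶜ] 0 := by
    intro i
    filter_upwards [ae_restrict_of_ae (coeFn_mulL _ hm (shiftL P O t (z i))), hsh i] with x h1 h2
    rw [h1, h2]; simp
  have hzsh : ∀ i, shiftL P O t (z i) = transL (a i) (shiftL P (ballO n ε) t u) := by
    intro i
    rw [shiftL_apply, shiftL_apply, hz1, hz2, map_sub, map_smul]
  have hnorm : ∀ i, ‖z i‖ = ‖u‖ := by
    intro i
    refine (sq_eq_sq₀ (norm_nonneg _) (norm_nonneg _)).1 ?_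
    rw [H0_norm_sq, H0_norm_sq, hz1, hz2, LinearIsometry.norm_map, LinearIsometry.norm_map]
  have hz0 : ∀ i, z i ≠ 0 := by
    intro i h
    have := hnorm i
    rw [h, norm_zero] at this
    exact hu0 (norm_eq_zero.1 this.symm)
  have horth : ∀ i j, i ≠ j → inner ℂ (z i) (z j) = 0 := by
    intro i j hij
    have e : inner ℂ (z i) (z j) = inner ℂ (fnL P O (z i)) (fnL P O (z j))
        + inner ℂ (opL P O (z i)) (opL P O (z j)) := WithLp.prod_inner_apply _ _
    rw [e, inner_eq_zero_of_disjoint (hfn i) (hfn j) measurableSet_ball measurableSet_ball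
      (hdisj i j hij), inner_eq_zero_of_disjoint (hop i) (hop j) measurableSet_ball
      measurableSet_ball (hdisj i j hij), add_zero]
  have hlin : LinearIndependent ℂ z :=
    linearIndependent_of_ne_zero_of_inner_eq_zero hz0 fun i j hij => horth i j hij
  refine ⟨t, Submodule.span ℂ (Set.range z), ?_, nonposOn_span _ z (fun i j hij => ?_) fun i => ?_⟩
  · rw [finrank_span_eq_card hlin, Fintype.card_fin]
  · rw [inner_transOp, inner_eq_zero_of_disjoint (hmsh i) (hsh j) measurableSet_ball
      measurableSet_ball (hdisj i j hij), inner_eq_zero_of_disjoint (hsh i) (hfn j)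
      measurableSet_ball measurableSet_ball (hdisj i j hij)]
    simp
  · rw [inner_transOp, map_sub]
    -- Replacing `m` by its upper bound `δ⁻¹` can only increase the form, and with `δ⁻¹` the value
    -- at a translate of `u` is exactly zero.
    have h1 := re_inner_mulL_le hm hmδ (shiftL_ae_eq_zero hΩ t (z i))
    have h2 : RCLike.re ((t : ℂ) * inner ℂ (shiftL P O t (z i)) (fnL P O (z i)))
        = t * RCLike.re (inner ℂ (shiftL P (ballO n ε) t u) (fnL P (ballO n ε) u)) := by
      rw [hzsh, hz1, LinearIsometry.inner_map_map]
      exact Complex.re_ofReal_mul _ _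
    rw [hzsh, LinearIsometry.norm_map, hu, ← hzsh] at h1
    rw [h2]
    have h3 : δ⁻¹ * (t * δ * RCLike.re (inner ℂ (shiftL P (ballO n ε) t u) (fnL P (ballO n ε) u)))
        = t * RCLike.re (inner ℂ (shiftL P (ballO n ε) t u) (fnL P (ballO n ε) u)) := by
      field_simp
    linarith

end AcousticITP
end

/-! ### Conclusion: bounded against unbounded index. -/

theorem proposition6p2 {n : ℕ} (P : MvPolynomial (Fin n) ℝ) (hP : 2 ≤ P.totalDegree)
    (hPweight : Tendsto (AcousticITP.weight P) (cocompact (AcousticITP.Rn n)) atTop)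
    (Ω : TopologicalSpace.Opens (AcousticITP.Rn n))
    (hΩconn : IsConnected (Ω : Set (AcousticITP.Rn n)))
    (hΩbdd : Bornology.IsBounded (Ω : Set (AcousticITP.Rn n)))
    (V : AcousticITP.Rn n → ℝ) (hV : MemLp V ∞ volume)
    (hVsupp : AcousticITP.essSupport V = closure (Ω : Set (AcousticITP.Rn n)))
    (hVpos : ∃ δ₀ : ℝ, 0 < δ₀ ∧
      ∀ᵐ x ∂(volume.restrict (closure (Ω : Set (AcousticITP.Rn n)))), δ₀ ≤ V x)
    (hball : ∀ ε δ : ℝ, 0 < ε → 0 < δ → ∃ μ : ℝ, μ ≠ 0 ∧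
      AcousticITP.IsTransmissionEigenvalue P (AcousticITP.ballO n ε) (fun _ => δ) (μ : ℂ)) :
    {μ : ℝ | AcousticITP.IsTransmissionEigenvalue P Ω V (μ : ℂ)}.Infinite := by
  intro hfin
  obtain ⟨δ₀, hδ₀, hVδ⟩ := hVpos
  have hdeg : P.totalDegree ≠ 0 := by omega
  have hn : 0 < n := by
    rcases Nat.eq_zero_or_pos n with rfl | h
    · exact absurd (by rw [MvPolynomial.eq_C_of_isEmpty P, MvPolynomial.totalDegree_C]) hdeg
    · exact h
  have hΩ : MeasurableSet (Ω : Set (AcousticITP.Rn n)) := Ω.isOpen.measurableSet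
  have hVδΩ : ∀ᵐ x ∂volume.restrict (Ω : Set (AcousticITP.Rn n)), δ₀ ≤ V x :=
    ae_restrict_of_ae_restrict_of_subset subset_closure hVδ
  obtain ⟨K, hK⟩ : ∃ K : ℝ, ∀ᵐ x, |V x| ≤ K := by
    refine ⟨(eLpNormEssSup V volume).toReal, ?_⟩
    have hlt : eLpNormEssSup V volume < ∞ := by simpa using hV.2
    filter_upwards [ae_le_eLpNormEssSup (f := V) (μ := volume)] with x hx
    have := ENNReal.toReal_mono hlt.ne hx
    simpa using this
  have hKΩ := ae_restrict_of_ae (s := (Ω : Set (AcousticITP.Rn n))) hK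
  -- The lower bound on `V` holds only near `Ω`, so `1 / V` is cut off to make it globally bounded.
  set m : AcousticITP.Rn n → ℝ := (Ω : Set (AcousticITP.Rn n)).indicator fun x => (V x)⁻¹ with hmdef
  have hmΩ : ∀ᵐ x ∂volume.restrict (Ω : Set (AcousticITP.Rn n)), m x = (V x)⁻¹ := by
    filter_upwards [ae_restrict_mem hΩ] with x hx
    exact Set.indicator_of_mem hx _
  have hmR : MemLp m ∞ volume := by
    rw [hmdef, memLp_indicator_iff_restrict hΩ]
    refine memLp_top_of_bound
      (hV.1.aemeasurable.inv.aestronglyMeasurable.restrict) δ₀⁻¹ ?_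
    filter_upwards [hVδΩ] with x hx
    rw [norm_inv, Real.norm_of_nonneg (hδ₀.le.trans hx)]
    exact inv_anti₀ hδ₀ hx
  have hm : MemLp (fun x => (m x : ℂ)) ∞ volume := hmR.ofReal
  have hmκ : ∀ᵐ x ∂volume.restrict (Ω : Set (AcousticITP.Rn n)), (|K| + 1)⁻¹ ≤ m x := by
    filter_upwards [hVδΩ, hKΩ, hmΩ] with x h1 h2 h3
    rw [h3]
    refine inv_anti₀ (hδ₀.trans_le h1) ?_
    linarith [le_abs_self (V x), le_abs_self K]
  have hVm : ∀ᵐ x ∂volume.restrict (Ω : Set (AcousticITP.Rn n)), V x * m x = 1 := by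
    filter_upwards [hVδΩ, hmΩ] with x h1 h3
    rw [h3, mul_inv_cancel₀ (hδ₀.trans_le h1).ne']
  have hmδ : ∀ᵐ x ∂volume.restrict (Ω : Set (AcousticITP.Rn n)), m x ≤ δ₀⁻¹ := by
    filter_upwards [hVδΩ, hmΩ] with x h1 h3
    rw [h3]
    exact inv_anti₀ hδ₀ h1
  obtain ⟨B, hB⟩ := AcousticITP.exists_bound_finrank_nonposOn
    (T := AcousticITP.transOp P (Ω : Set (AcousticITP.Rn n)) m hm)
    AcousticITP.continuous_transOp (fun t => AcousticITP.isSelfAdjoint_transOp t)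
    (fun t => AcousticITP.finiteRankGarding_transOp hPweight hΩ hΩbdd (by positivity) hmκ t)
    -- The parameter `0` is excluded as well, since recovering `w` from `u` divides by `t`.
    (hfin.insert 0) (fun t ht u hu => by
      rw [Set.mem_insert_iff, not_or] at ht
      by_contra hu0
      exact ht.2 (AcousticITP.isTransmissionEigenvalue_of_transOp_eq_zero hdeg hΩbdd hKΩ hVm ht.1
        hu hu0))
  obtain ⟨t, W, hW, hWn⟩ := AcousticITP.exists_nonposOn_transOp (hm := hm) hn hΩconn.nonempty hδ₀ hmδ
    (fun ε hε => hball ε δ₀ hε hδ₀) (B + 1)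
  have := hB t W hWn
  omega
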